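/- Let $k$ be a field of characteristic different from $2$ with algebraic closure $\bar k$. Let $g\in k[x,y,z]$ be homogeneous of degree $4$ such that the surface $X\subset\mathbb P(1,1,1,2)$ given by $w^2=g$ is smooth (a del Pezzo surface of degree $2$), and let $B\subset\mathbb P^2$ be its branch curve $g=0$. Let $d\ge 2$, let $f_{d-1},f_d\in k[x,y]$ be coprime homogeneous polynomials of degrees $d-1$ and $d$, and let $C\subset\mathbb P^2$ be the (geometrically irreducible) curve $z f_{d-1}=f_d$, on which $Q=(0:0:1)$ is a point of multiplicity $d-1$. Put $$G=g\bigl(s f_{d-1}(s,t),\,t f_{d-1}(s,t),\,f_d(s,t)\bigr)\in k[s,t].$$ For $S\in C(\bar k)$, let $\mu_S(C,B)$ be the intersection multiplicity of $C$ and $B$ at $S$ over $\bar k$, that is, the length of the $\mathcal O_{S,C_{\bar k}}$-module $\mathcal O_{S,C_{\bar k}}/(\beta)$, where $\beta=0$ is a local equation of $B$ at $S$. Let $b(C,B)$ be the set of $S\in C(\bar k)$ for which $\mu_S(C,B)$ is odd. Suppose that $Q\in B$. Then $H=G/f_{d-1}(s,t)$ lies in $k[s,t]$. Suppose furthermore that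 the tangent line to $B$ at $Q$ is given by $h=0$ with $h\in k[x,y]$ a linear form, and that $Q$ is an ordinary singular point of $C$ (a singular point of some multiplicity $m\geq 2$ with $m$ distinct tangent lines over $\bar k$). Then the following hold. 1. Suppose $d$ is odd. Then $b(C,B)=\emptyset$ if and only if $H$ is a square in $\bar k[s,t]$. 2. Suppose $d$ is even. If $h$ divides $f_{d-1}$, then $H/h(s,t)$ lies in $k[s,t]$. Moreover, $b(C,B)=\emptyset$ if and only if $h$ divides $f_{d-1}$ and $H/h(s,t)$ is a square in $\bar k[s,t]$. -/

import Mathlib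

open MvPolynomial
open scoped LinearAlgebra.Projectivization

namespace QuarticPlane

noncomputable section

/-! ### Points and affine charts of the projective plane -/

/-- The index of the first nonzero homogeneous coordinate of a point of the projective plane. -/
def chart {K : Type*} [Field K] (S : ℙ K (Fin 3 → K)) : Fin 3 :=
  open Classical in if S.rep 0 ≠ 0 then 0 else if S.rep 1 ≠ 0 then 1 else 2

/-- The affine coordinates of the point `S` in the chart `x_i ≠ 0`, for `i = chart S`. -/
def affineCoord {K : Type*} [Field K] (S : ℙ K (Fin 3 → K)) : Fin 2 → K :=
  fun j => S.rep ((chart S).succAbove j) / S.rep (chart S)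

/-- Dehomogenisation with respect to the variable `x_i`: put `x_i = 1` and keep the other two
variables, in the same order. -/
def dehomogenize {K : Type*} [Field K] (i : Fin 3) (F : MvPolynomial (Fin 3) K) :
    MvPolynomial (Fin 2) K :=
  aeval (i.insertNth (1 : MvPolynomial (Fin 2) K) (fun j => X j)) F

/-! ### Intersection multiplicities -/

instance isPrime_ker_eval {K : Type*} [Field K] (a : Fin 2 → K) :
    (RingHom.ker (MvPolynomial.eval a)).IsPrime :=
  RingHom.ker_isPrime _

/-- The local ring of the affine plane over `K` at the point `a`. -/
abbrev PlaneLocalRing {K : Type*} [Field K] (a : Fin 2 → K) : Type _ :=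
  Localization.AtPrime (RingHom.ker (MvPolynomial.eval a))

/-- The local ring at `a` of the affine plane curve given by `f = 0`. -/
abbrev CurveLocalRing {K : Type*} [Field K] (f : MvPolynomial (Fin 2) K) (a : Fin 2 → K) :
    Type _ :=
  PlaneLocalRing a ⧸ Ideal.span {algebraMap (MvPolynomial (Fin 2) K) (PlaneLocalRing a) f}

/-- The image of the polynomial `g` in the local ring at `a` of the curve `f = 0`. -/
def toCurveLocalRing {K : Type*} [Field K] (f : MvPolynomial (Fin 2) K) (a : Fin 2 → K)
    (g : MvPolynomial (Fin 2) K) : CurveLocalRing f a :=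
  Ideal.Quotient.mk _ (algebraMap (MvPolynomial (Fin 2) K) (PlaneLocalRing a) g)

/-- The intersection multiplicity at `S` of the projective plane curves `F = 0` and `G = 0`
(homogeneous `F` and `G`): the length of the module `𝒪 / (g)` over the local ring `𝒪` at `S` of
the first curve, where `g = 0` is the equation of the second curve in an affine chart around `S`.
It does not depend on the affine chart. -/
def intersectionMultiplicity {K : Type*} [Field K] (F G : MvPolynomial (Fin 3) K)
    (S : ℙ K (Fin 3 → K)) : ℕ∞ :=
  Module.length (CurveLocalRing (dehomogenize (chart S) F) (affineCoord S))
    (CurveLocalRing (dehomogenize (chart S) F) (affineCoord S) ⧸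
      Ideal.span {toCurveLocalRing (dehomogenize (chart S) F) (affineCoord S)
        (dehomogenize (chart S) G)})

/-- The set of points of the curve `F = 0` at which its intersection multiplicity with the curve
`G = 0` is odd. -/
def oddPoints {K : Type*} [Field K] (F G : MvPolynomial (Fin 3) K) : Set (ℙ K (Fin 3 → K)) :=
  {S | MvPolynomial.eval S.rep F = 0 ∧
    ∃ n : ℕ, intersectionMultiplicity F G S = (n : ℕ∞) ∧ Odd n}

/-! ### Ordinary singular points and tangent lines -/

/-- Over an algebraically closed field `K`, the point `S` is an ordinary singular point of the
curve `F = 0`: in affine coordinates centred at `S`, the equation has a lowest degree form of some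
degree `m ≥ 2` (the multiplicity of `S`), and this form has `m` distinct zeros in the projective
line, that is, there are `m` distinct tangent lines. -/
def IsOrdinarySingularPoint {K : Type*} [Field K] (F : MvPolynomial (Fin 3) K)
    (S : ℙ K (Fin 3 → K)) : Prop :=
  let f : MvPolynomial (Fin 2) K :=
    aeval (fun j => X j + C (affineCoord S j)) (dehomogenize (chart S) F)
  ∃ m : ℕ, 2 ≤ m ∧ (∀ i < m, homogeneousComponent i f = 0) ∧ homogeneousComponent m f ≠ 0 ∧
    Set.ncard {T : ℙ K (Fin 2 → K) | MvPolynomial.eval T.rep (homogeneousComponent m f) = 0} = m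

/-- The linear form that defines the tangent line to the curve `g = 0` at its smooth point with
homogeneous coordinates `p`. -/
def tangentForm {k : Type*} [Field k] (g : MvPolynomial (Fin 3) k) (p : Fin 3 → k) :
    MvPolynomial (Fin 3) k :=
  ∑ i, C (MvPolynomial.eval p (pderiv i g)) * X i

/-- The tangent line to the curve `g = 0` at the point `(0 : 0 : 1)` is given by `h = 0`, where
`h` is a polynomial in the first two variables only. -/
def IsTangentLineAtQ {k : Type*} [Field k] (g : MvPolynomial (Fin 3) k)
    (h : MvPolynomial (Fin 2) k) : Prop :=
  ∃ c : k, c ≠ 0 ∧ rename Fin.castSucc h = C c * tangentForm g ![0, 0, 1]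

/-! ### The objects of the statement -/

/-- The polynomial `w ^ 2 - g`, in the variables `x, y, z, w`. -/
def doublePlane {k : Type*} [Field k] (g : MvPolynomial (Fin 3) k) : MvPolynomial (Fin 4) k :=
  X 3 ^ 2 - rename Fin.castSucc g

/-- For `g` homogeneous of degree `4`, the surface `w ^ 2 = g` in the weighted projective space
`ℙ(1, 1, 1, 2)` is smooth, that is, it is a del Pezzo surface of degree `2`; here `K` is an
algebraic closure of the base field. As the surface does not contain the point `(0 : 0 : 0 : 1)`,
smoothness is given by the Jacobian criterion. -/
def IsDelPezzoDoublePlane {k : Type*} (K : Type*) [Field k] [Field K] [Algebra k K]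
    (g : MvPolynomial (Fin 3) k) : Prop :=
  ∀ p : Fin 4 → K, p ≠ 0 → aeval p (doublePlane g) = 0 →
    ∃ i, aeval p (pderiv i (doublePlane g)) ≠ 0

/-- The equation `z * f₁ - f₂` of the plane curve `z * f₁ = f₂`, where `f₁` and `f₂` are
polynomials in `x` and `y`. -/
def curvePoly {k : Type*} [Field k] (f₁ f₂ : MvPolynomial (Fin 2) k) : MvPolynomial (Fin 3) k :=
  X 2 * rename Fin.castSucc f₁ - rename Fin.castSucc f₂

/-- The polynomial `G = g (s * f₁, t * f₁, f₂)` in the variables `s, t`. -/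
def pullbackPoly {k : Type*} [Field k] (g : MvPolynomial (Fin 3) k)
    (f₁ f₂ : MvPolynomial (Fin 2) k) : MvPolynomial (Fin 2) k :=
  aeval ![X 0 * f₁, X 1 * f₁, f₂] g

/-- The point `Q = (0 : 0 : 1)` of the projective plane. -/
def pointQ (K : Type*) [Field K] : ℙ K (Fin 3 → K) :=
  Projectivization.mk K ![0, 0, 1] (fun h => one_ne_zero (congrFun h 2))

end

end QuarticPlane

/-! Write e = d - 1, and f₁, f₂ for the forms of degrees e and e + 1. The map p ↦ (p₀f₁ : p₁f₁ : f₂)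
identifies the locus f₁ ≠ 0 in ℙ¹ with C minus Q. On C the relation z f₁ = f₂ and homogeneity give
f₁⁴ g = G = f₁ H (`aeval_curvePoly_dvd`), so at the point coming from p the intersection
multiplicity is the order of H at p (`relOrd_eq_mult`).

At Q the curve C is f₁ - f₂ = 0 in the affine plane. A line through Q in direction p meets it with
multiplicity e, or e + 1 if f₁(p) = 0 (`lin_relOrd_origin`). Taylor expansion of g at Q shows that H
is f₂³ h modulo f₁, up to a nonzero constant (`sq_dvd_pullbackPoly_sub`), so f₁ and H can only share
the zero q of h. Cancelling f₁ leaves f₁³ g = H on C. Splitting f₁ and H into linear factors then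
gives 3e(e+1) + μ_Q = e(3e+4) + E, where E is the order of H at q if f₁(q) = 0, and 0 otherwise.
Hence μ_Q = e + E (`relOrd_origin`).

A binary form over an algebraically closed field is a square exactly when all its orders are even
(`isSquare_iff_forall_even_mult`). For e even the parity conditions say this of H. For e odd,
evenness of e + E forces f₁(q) = 0 and an odd order at q, so that H is h times a square. -/

namespace QuarticPlane

/-! ### Binary forms: linear factors, orders of vanishing, squares. -/

section BinaryForms

variable {K : Type*} [Field K]

theorem aeval_mul_of_isHomogeneous {σ A : Type*} [CommRing A] [Algebra K A]
    {F : MvPolynomial σ K} {n : ℕ} (hF : F.IsHomogeneous n) (r : A) (v : σ → A) :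
    aeval (fun i => r * v i) F = r ^ n * aeval v F := by
  rw [aeval_def, aeval_def, eval₂_eq, eval₂_eq, Finset.mul_sum]
  refine Finset.sum_congr rfl fun m hm => ?_
  have hdeg := hF.degree_eq_sum_deg_support hm
  simp only [mul_pow, Finset.prod_mul_distrib, Finset.prod_pow_eq_pow_sum]
  rw [show ∑ i ∈ m.support, m i = n by simpa [Finsupp.degree] using hdeg.symm]
  ring

theorem eval_smul_of_isHomogeneous {σ : Type*} {F : MvPolynomial σ K} {n : ℕ}
    (hF : F.IsHomogeneous n) (r : K) (v : σ → K) : eval (r • v) F = r ^ n * eval v F := by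
  have h := aeval_mul_of_isHomogeneous hF r v
  rw [aeval_eq_eval, aeval_eq_eval] at h
  exact h

theorem homogeneousComponent_mul_of_isHomogeneous {σ : Type*} {A : MvPolynomial σ K} {m : ℕ}
    (hA : A.IsHomogeneous m) (B : MvPolynomial σ K) (n : ℕ) :
    homogeneousComponent (m + n) (A * B) = A * homogeneousComponent n B := by
  conv_lhs => rw [← sum_homogeneousComponent B, Finset.mul_sum, map_sum]
  have h : ∀ i, homogeneousComponent (m + n) (A * homogeneousComponent i B) =
      if i = n then A * homogeneousComponent n B else 0 := fun i => by
    rw [homogeneousComponent_of_mem (hA.mul (homogeneousComponent_isHomogeneous i B))]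
    by_cases h : i = n
    · subst h; simp
    · simp [h, Ne.symm h]
  simp only [h, Finset.sum_ite_eq', Finset.mem_range]
  split_ifs with hlt
  · rfl
  · rw [homogeneousComponent_eq_zero _ _ (by omega), mul_zero]

theorem IsHomogeneous.of_mul_left {σ : Type*} {A B : MvPolynomial σ K} {m n : ℕ}
    (hA : A.IsHomogeneous m) (hA0 : A ≠ 0) (h : (A * B).IsHomogeneous (m + n)) :
    B.IsHomogeneous n := by
  have h1 := homogeneousComponent_mul_of_isHomogeneous hA B n
  rw [homogeneousComponent_of_mem h, if_pos rfl] at h1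
  rw [mul_left_cancel₀ hA0 h1]
  exact homogeneousComponent_isHomogeneous n B

theorem prime_of_totalDegree_eq_one {σ : Type*} {F : MvPolynomial σ K} (hF : F.totalDegree = 1) :
    Prime F := by
  refine (irreducible_of_totalDegree_eq_one hF fun x hx => ?_).prime
  have hF0 : F ≠ 0 := by rintro rfl; simp at hF
  obtain ⟨i, hi⟩ := ne_zero_iff.mp hF0
  exact isUnit_iff_ne_zero.mpr fun h0 => hi (by simpa [h0] using hx i)

theorem prime_X_sub_C {σ : Type*} (i : σ) (a : K) : Prime (X i - C a : MvPolynomial σ K) := by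
  refine prime_of_totalDegree_eq_one (le_antisymm ?_ ?_)
  · exact (totalDegree_sub_C_le _ _).trans (by simp)
  · have : (Finsupp.single i 1 : σ →₀ ℕ) ∈ (X i - C a : MvPolynomial σ K).support := by
      classical
      simp [mem_support_iff, coeff_C, coeff_X, (Finsupp.single_ne_zero.mpr one_ne_zero).symm]
    simpa using le_totalDegree this

/-- The linear form that vanishes at `p`. -/
noncomputable def lin (p : Fin 2 → K) : MvPolynomial (Fin 2) K := C (p 1) * X 0 - C (p 0) * X 1

@[simp] theorem eval_lin (p q : Fin 2 → K) : eval q (lin p) = p 1 * q 0 - p 0 * q 1 := by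
  simp [lin]

theorem isHomogeneous_lin (p : Fin 2 → K) : (lin p).IsHomogeneous 1 :=
  (isHomogeneous_C_mul_X _ _).sub (isHomogeneous_C_mul_X _ _)

/-- Such a `q` makes `lin p`, `lin q` a basis of the linear forms, with `lin q` equal to 1 at `p`.
-/
theorem exists_eval_lin_eq_one {p : Fin 2 → K} (hp : p ≠ 0) :
    ∃ q : Fin 2 → K, q 1 * p 0 - q 0 * p 1 = 1 := by
  by_cases h : p 0 = 0
  · have h1 : p 1 ≠ 0 := fun h1 => hp (by ext i; fin_cases i <;> simpa)
    exact ⟨![-(p 1)⁻¹, 0], by simp [h1]⟩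
  · exact ⟨![0, (p 0)⁻¹], by simp [h]⟩

theorem lin_ne_zero {p : Fin 2 → K} (hp : p ≠ 0) : lin p ≠ 0 := by
  obtain ⟨q, hq⟩ := exists_eval_lin_eq_one hp
  intro h
  have := eval_lin p q
  rw [h, map_zero] at this
  exact one_ne_zero (α := K) (by linear_combination -hq + this)

theorem prime_lin {p : Fin 2 → K} (hp : p ≠ 0) : Prime (lin p) :=
  prime_of_totalDegree_eq_one ((isHomogeneous_lin p).totalDegree (lin_ne_zero hp))

theorem lin_smul (c : K) (p : Fin 2 → K) : lin (c • p) = C c * lin p := by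
  simp [lin]; ring

/-- The vector of variables equals `lin q` times `p` minus `lin p` times `q`. Modulo `lin p` it is
therefore a multiple of `p`, and homogeneity pulls out the factor. -/
theorem lin_dvd_sub {F : MvPolynomial (Fin 2) K} {n : ℕ} (hF : F.IsHomogeneous n)
    {p q : Fin 2 → K} (hq : q 1 * p 0 - q 0 * p 1 = 1) :
    lin p ∣ F - C (eval p F) * lin q ^ n := by
  rw [← Ideal.mem_span_singleton, ← Ideal.Quotient.eq]
  set I := Ideal.span {lin p}
  let φ := Ideal.Quotient.mkₐ K I
  have hlin : φ (lin p) = 0 :=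
    Ideal.Quotient.eq_zero_iff_mem.mpr (Ideal.mem_span_singleton_self _)
  have hX : ∀ i, φ (X i) = φ (lin q) * algebraMap K _ (p i) := fun i => by
    have : X i - lin q * C (p i) = C (-q i) * lin p := by
      have hC : (C (q 1) * C (p 0) - C (q 0) * C (p 1) : MvPolynomial (Fin 2) K) = 1 := by
        rw [← C_mul, ← C_mul, ← C_sub, hq, C_1]
      fin_cases i
      · simp only [lin, Fin.zero_eta, C_neg]; linear_combination (-X 0) * hC
      · simp only [lin, Fin.mk_one, C_neg]; linear_combination (-X 1) * hC
    have h2 := congrArg φ this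
    rw [map_sub, map_mul, map_mul, hlin, mul_zero, sub_eq_zero] at h2
    rw [h2, ← AlgHom.commutes φ]; rfl
  have h1 : φ F = aeval (fun i => φ (lin q) * algebraMap K _ (p i)) F := by
    conv_lhs => rw [← aeval_X_left_apply F, ← AlgHom.comp_apply, comp_aeval]
    simp only [hX]
  change φ F = φ _
  rw [h1, aeval_mul_of_isHomogeneous hF, map_mul, map_pow, mul_comm]
  congr 1
  exact (aeval_algebraMap_apply _ p F).trans (AlgHom.commutes φ _).symm

theorem lin_dvd_iff {F : MvPolynomial (Fin 2) K} {n : ℕ} (hF : F.IsHomogeneous n)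
    {p : Fin 2 → K} (hp : p ≠ 0) : lin p ∣ F ↔ eval p F = 0 := by
  obtain ⟨q, hq⟩ := exists_eval_lin_eq_one hp
  constructor
  · rintro ⟨m, rfl⟩
    simp [mul_comm]
  · intro h
    simpa [h] using lin_dvd_sub hF hq

theorem exists_smul_eq_of_lin {p q : Fin 2 → K} (hp : p ≠ 0) (h : p 1 * q 0 - p 0 * q 1 = 0) :
    ∃ c : K, q = c • p := by
  by_cases h0 : p 0 = 0
  · have h1 : p 1 ≠ 0 := fun h1 => hp (by ext i; fin_cases i <;> simpa)
    refine ⟨q 1 / p 1, ?_⟩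
    have : q 0 = 0 := by simpa [h0, h1] using h
    ext i; fin_cases i <;> simp [h0, h1, this]
  · refine ⟨q 0 / p 0, ?_⟩
    ext i; fin_cases i
    · simp [h0]
    · simp; field_simp; linear_combination -h

theorem associated_lin_smul {c : K} (hc : c ≠ 0) (p : Fin 2 → K) :
    Associated (lin p) (lin (c • p)) := by
  obtain ⟨u, hu⟩ := (isUnit_iff_ne_zero.mpr hc).map (C : K →+* MvPolynomial (Fin 2) K)
  exact ⟨u, by rw [hu, mul_comm, lin_smul]⟩

theorem associated_lin_iff {p q : Fin 2 → K} (hp : p ≠ 0) (hq : q ≠ 0) :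
    Associated (lin p) (lin q) ↔ p 1 * q 0 - p 0 * q 1 = 0 := by
  constructor
  · intro h
    have h1 := (lin_dvd_iff (isHomogeneous_lin q) hp).mp h.dvd
    rw [eval_lin] at h1
    linear_combination -h1
  · intro h
    obtain ⟨c, rfl⟩ := exists_smul_eq_of_lin hp h
    refine associated_lin_smul ?_ _
    rintro rfl
    simp at hq

/-- Put the second variable equal to 1 and take a root. If a nonzero constant is left, the form is a
multiple of the n-th power of the second variable and vanishes at (1 : 0). -/
theorem exists_eval_eq_zero [IsAlgClosed K] {F : MvPolynomial (Fin 2) K} {n : ℕ}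
    (hF : F.IsHomogeneous n) (hn : n ≠ 0) : ∃ p : Fin 2 → K, p ≠ 0 ∧ eval p F = 0 := by
  by_cases h : (aeval ![Polynomial.X, 1] F : Polynomial K).degree = 0
  · obtain ⟨c, hc⟩ := Polynomial.natDegree_eq_zero.mp (Polynomial.natDegree_eq_of_degree_eq_some h)
    have := Polynomial.homogenize_eq_of_isHomogeneous hF hc.symm
    refine ⟨![1, 0], fun h => one_ne_zero (congrFun h 0), ?_⟩
    rw [← this, Polynomial.homogenize_C]
    simp [hn]
  · obtain ⟨a, ha⟩ := IsAlgClosed.exists_root _ h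
    refine ⟨![a, 1], fun h => one_ne_zero (congrFun h 1), ?_⟩
    rw [Polynomial.IsRoot, ← Polynomial.coe_aeval_eq_eval, comp_aeval_apply] at ha
    rw [← ha, ← aeval_eq_eval]
    congr 2
    ext i; fin_cases i <;> simp

/-- A binary form over an algebraically closed field is a product of linear forms. -/
theorem binaryForm_induction [IsAlgClosed K] {P : ℕ → MvPolynomial (Fin 2) K → Prop}
    (hC : ∀ c : K, c ≠ 0 → P 0 (C c))
    (hmul : ∀ (n : ℕ) (p : Fin 2 → K) (F : MvPolynomial (Fin 2) K), p ≠ 0 → F.IsHomogeneous n →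
      F ≠ 0 → P n F → P (n + 1) (lin p * F))
    {n : ℕ} {F : MvPolynomial (Fin 2) K} (hF : F.IsHomogeneous n) (hF0 : F ≠ 0) : P n F := by
  induction n generalizing F with
  | zero =>
    rw [← totalDegree_zero_iff_isHomogeneous] at hF
    obtain ⟨c, rfl⟩ : ∃ c, F = C c := ⟨_, totalDegree_eq_zero_iff_eq_C.mp hF⟩
    exact hC c fun h => hF0 (by simp [h])
  | succ n ih =>
    obtain ⟨p, hp, h0⟩ := exists_eval_eq_zero hF n.succ_ne_zero
    obtain ⟨F', rfl⟩ := (lin_dvd_iff hF hp).mpr h0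
    have hF' : F'.IsHomogeneous n :=
      IsHomogeneous.of_mul_left (isHomogeneous_lin p) (lin_ne_zero hp) (by rwa [add_comm])
    exact hmul n p F' hp hF' (right_ne_zero_of_mul hF0) (ih hF' (right_ne_zero_of_mul hF0))

/-- The order of vanishing at `p` of a binary form. -/
noncomputable def mult (p : Fin 2 → K) (F : MvPolynomial (Fin 2) K) : ℕ := multiplicity (lin p) F

theorem finiteMultiplicity_lin {p : Fin 2 → K} (hp : p ≠ 0) {F : MvPolynomial (Fin 2) K}
    (hF : F ≠ 0) : FiniteMultiplicity (lin p) F :=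
  FiniteMultiplicity.of_not_isUnit (prime_lin hp).not_isUnit hF

theorem mult_mul {p : Fin 2 → K} (hp : p ≠ 0) {F G : MvPolynomial (Fin 2) K}
    (hF : F ≠ 0) (hG : G ≠ 0) : mult p (F * G) = mult p F + mult p G :=
  multiplicity_mul (prime_lin hp) (finiteMultiplicity_lin hp (mul_ne_zero hF hG))

theorem mult_eq_zero {p : Fin 2 → K} {F : MvPolynomial (Fin 2) K} :
    mult p F = 0 ↔ ¬ lin p ∣ F :=
  multiplicity_eq_zero

theorem mult_C {p : Fin 2 → K} (hp : p ≠ 0) {c : K} (hc : c ≠ 0) : mult p (C c) = 0 :=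
  multiplicity_of_isUnit_right (prime_lin hp).not_isUnit ((isUnit_iff_ne_zero.mpr hc).map C)

theorem mult_lin {p q : Fin 2 → K} (hp : p ≠ 0) (hq : q ≠ 0) [Decidable (eval p (lin q) = 0)] :
    mult p (lin q) = if eval p (lin q) = 0 then 1 else 0 := by
  split_ifs with h
  · rw [eval_lin] at h
    have := (associated_lin_iff hp hq).mpr (by linear_combination -h)
    rw [mult, ← multiplicity_eq_of_associated_right this, multiplicity_self]
  · rw [mult_eq_zero, lin_dvd_iff (isHomogeneous_lin q) hp]
    exact h

theorem mult_smul {c : K} (hc : c ≠ 0) (p : Fin 2 → K) (F : MvPolynomial (Fin 2) K) :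
    mult (c • p) F = mult p F :=
  multiplicity_eq_of_associated_left (associated_lin_smul hc p)

theorem isSquare_iff_forall_even_mult [IsAlgClosed K] {F : MvPolynomial (Fin 2) K} {n : ℕ}
    (hF : F.IsHomogeneous n) (hF0 : F ≠ 0) :
    IsSquare F ↔ ∀ p : Fin 2 → K, p ≠ 0 → Even (mult p F) := by
  constructor
  · rintro ⟨M, rfl⟩ p hp
    have := left_ne_zero_of_mul hF0
    exact ⟨_, mult_mul hp this this⟩
  induction n using Nat.strong_induction_on generalizing F with
  | _ n ih =>
  intro h
  rcases Nat.eq_zero_or_pos n with rfl | hn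
  · rw [← totalDegree_zero_iff_isHomogeneous, totalDegree_eq_zero_iff_eq_C] at hF
    obtain ⟨r, hr⟩ := IsAlgClosed.exists_pow_nat_eq (coeff 0 F) (two_pos)
    exact ⟨C r, by rw [hF, ← C_mul, ← sq, hr]⟩
  obtain ⟨p, hp, h0⟩ := exists_eval_eq_zero hF hn.ne'
  have hdvd : lin p ^ 2 ∣ F := by
    refine pow_dvd_of_le_multiplicity ?_
    have h1 : mult p F ≠ 0 := fun h1 => mult_eq_zero.mp h1 ((lin_dvd_iff hF hp).mpr h0)
    have h2 := h p hp
    rw [← mult]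
    obtain ⟨m, hm⟩ := h2
    omega
  obtain ⟨F', rfl⟩ := hdvd
  have hl : lin p ^ 2 ≠ 0 := pow_ne_zero _ (lin_ne_zero hp)
  have hF'0 := right_ne_zero_of_mul hF0
  have hl2 : (lin p ^ 2).IsHomogeneous 2 := by simpa using (isHomogeneous_lin p).pow 2
  have hn2 : 2 ≤ n := by
    by_contra hlt
    have h3 := hF.totalDegree hF0
    rw [totalDegree_mul_of_isDomain hl hF'0, hl2.totalDegree hl] at h3
    omega
  have hF' : F'.IsHomogeneous (n - 2) :=
    IsHomogeneous.of_mul_left hl2 hl (by rwa [Nat.add_sub_cancel' hn2])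
  obtain ⟨M, hM⟩ := ih (n - 2) (by omega) hF' hF'0 fun q hq => by
    have h3 := h q hq
    have h4 : mult q (lin p ^ 2) = mult q (lin p) + mult q (lin p) := by
      rw [sq, mult_mul hq (lin_ne_zero hp) (lin_ne_zero hp)]
    rw [mult_mul hq hl hF'0, h4, Nat.even_add] at h3
    exact h3.mp ⟨_, rfl⟩
  exact ⟨lin p * M, by rw [hM]; ring⟩

end BinaryForms

/-- Coprime binary forms have no common zero over an algebraic extension of the base field. -/
theorem eval_map_ne_zero_of_isRelPrime {k K : Type*} [Field k] [Field K] [Algebra k K]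
    [Algebra.IsAlgebraic k K] {F₁ F₂ : MvPolynomial (Fin 2) k} {m n : ℕ}
    (h₁ : F₁.IsHomogeneous m) (h₂ : F₂.IsHomogeneous n) (h : IsRelPrime F₁ F₂)
    {p : Fin 2 → K} (hp : p ≠ 0) (hp₁ : aeval p F₁ = 0) : aeval p F₂ ≠ 0 := by
  intro hp₂
  have hscale : ∀ {F : MvPolynomial (Fin 2) k} {l : ℕ}, F.IsHomogeneous l → aeval p F = 0 →
      ∀ r : K, r ≠ 0 → aeval (r • p) F = 0 := fun hF h0 r _ => by
    have := aeval_mul_of_isHomogeneous hF r p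
    rw [h0, mul_zero] at this
    exact this
  -- A common divisor with a zero is not a unit. It is a linear form if the point is (1 : 0), and
  -- otherwise the homogenised minimal polynomial of the affine coordinate.
  suffices ∃ D : MvPolynomial (Fin 2) k, D ∣ F₁ ∧ D ∣ F₂ ∧ ∃ q : Fin 2 → K, aeval q D = 0 by
    obtain ⟨D, hD₁, hD₂, q, hq⟩ := this
    exact not_isUnit_zero (hq ▸ (h hD₁ hD₂).map (aeval q))
  by_cases h1 : p 1 = 0
  · have h0 : p 0 ≠ 0 := fun h0 => hp (by ext i; fin_cases i <;> simpa)
    have he : (![1, 0] : Fin 2 → k) ≠ 0 := fun h => one_ne_zero (congrFun h 0)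
    have hq : (p 0)⁻¹ • p = algebraMap k K ∘ ![1, 0] := by
      ext i; fin_cases i <;> simp [h0, h1]
    have key : ∀ {F : MvPolynomial (Fin 2) k} {l : ℕ}, F.IsHomogeneous l → aeval p F = 0 →
        lin ![1, 0] ∣ F := fun {F l} hF h0F => by
      have h2 := hscale hF h0F (p 0)⁻¹ (inv_ne_zero h0)
      rw [hq, aeval_algebraMap_apply] at h2
      exact (lin_dvd_iff hF he).mpr ((map_eq_zero (algebraMap k K)).mp h2)
    exact ⟨_, key h₁ hp₁, key h₂ hp₂, ![1, 0], by simp [lin]⟩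
  · set a := p 0 / p 1
    have hq : (p 1)⁻¹ • p = ![a, 1] := by
      ext i; fin_cases i <;> simp [a, h1, div_eq_inv_mul]
    have key : ∀ {F : MvPolynomial (Fin 2) k} {l : ℕ}, F.IsHomogeneous l → aeval p F = 0 →
        (minpoly k a).homogenize (minpoly k a).natDegree ∣ F := fun {F l} hF h0F => by
      by_cases hF0 : F = 0
      · simp [hF0]
      have h2 := hscale hF h0F (p 1)⁻¹ (inv_ne_zero h1)
      rw [hq] at h2
      have h3 : minpoly k a ∣ aeval ![Polynomial.X, 1] F := minpoly.dvd k a <| by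
        rw [comp_aeval_apply, ← h2]
        congr 2
        ext i; fin_cases i <;> simp
      have hF' := Polynomial.homogenize_eq_of_isHomogeneous hF rfl
      have hdeg : (aeval ![Polynomial.X, 1] F : Polynomial k).natDegree ≤ l := by
        simpa using aeval_natDegree_le F hF.totalDegree_le ![Polynomial.X, 1] (n := 1)
          (fun i => by fin_cases i <;> simp)
      obtain ⟨q, hq⟩ := h3
      have hq0 : q ≠ 0 := by
        rintro rfl
        rw [mul_zero] at hq
        exact hF0 (by rw [← hF', hq, Polynomial.homogenize_zero])
      rw [hq] at hF' hdeg
      have hmin : minpoly k a ≠ 0 := minpoly.ne_zero (Algebra.IsIntegral.isIntegral a)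
      rw [Polynomial.natDegree_mul hmin hq0] at hdeg
      rw [← hF', ← Nat.add_sub_cancel' (le_trans (Nat.le_add_right _ _) hdeg),
        Polynomial.homogenize_mul _ _ le_rfl (by omega)]
      exact dvd_mul_right _ _
    refine ⟨_, key h₁ hp₁, key h₂ hp₂, ![a, 1], ?_⟩
    rw [Polynomial.aeval_homogenize_of_eq_one le_rfl _ (by simp)]
    simp

/-! ### Intersection numbers in a commutative ring. -/

section RelativeOrder

variable {R : Type*} [CommRing R]

/-- The order of vanishing of `g` on the closed subscheme `f = 0`. -/
noncomputable def relOrd (f g : R) : ℕ∞ :=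
  Ring.ord (R ⧸ Ideal.span {f}) (Ideal.Quotient.mk _ g)

/-- The element `g` is not a zero divisor modulo `f`. -/
def RegularMod (f g : R) : Prop := ∀ x, f ∣ g * x → f ∣ x

theorem RegularMod.mk_mem_nonZeroDivisors {f g : R} (h : RegularMod f g) :
    Ideal.Quotient.mk (Ideal.span {f}) g ∈ nonZeroDivisors (R ⧸ Ideal.span {f}) := by
  rw [mem_nonZeroDivisors_iff_left]
  intro x hx
  obtain ⟨x, rfl⟩ := Ideal.Quotient.mk_surjective x
  rw [← map_mul, Ideal.Quotient.eq_zero_iff_dvd] at hx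
  exact (Ideal.Quotient.eq_zero_iff_dvd _ _).mpr (h x hx)

theorem RegularMod.mul {f g₁ g₂ : R} (h₁ : RegularMod f g₁) (h₂ : RegularMod f g₂) :
    RegularMod f (g₁ * g₂) :=
  fun x hx => h₂ x (h₁ _ (by rwa [mul_assoc] at hx))

theorem RegularMod.of_isUnit {f g : R} (h : IsUnit g) : RegularMod f g :=
  fun _ hx => h.dvd_mul_left.mp hx

theorem RegularMod.of_prime [IsDomain R] {f g : R} (hg : Prime g) (h : ¬ g ∣ f) :
    RegularMod f g := by
  rintro x ⟨y, hy⟩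
  obtain ⟨z, rfl⟩ := (hg.dvd_or_dvd (hy ▸ dvd_mul_right g x)).resolve_left h
  exact ⟨z, mul_left_cancel₀ hg.ne_zero (by rw [hy]; ring)⟩

theorem relOrd_mul {f g₁ : R} (h : RegularMod f g₁) (g₂ : R) :
    relOrd f (g₁ * g₂) = relOrd f g₁ + relOrd f g₂ := by
  rw [relOrd, map_mul, Ring.ord_mul' _ h.mk_mem_nonZeroDivisors]; rfl

theorem relOrd_pow {f g : R} (h : RegularMod f g) (n : ℕ) :
    relOrd f (g ^ n) = n * relOrd f g := by
  rw [relOrd, map_pow, Ring.ord_pow h.mk_mem_nonZeroDivisors, nsmul_eq_mul]; rfl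

theorem relOrd_congr {f g g' : R} (h : f ∣ g - g') : relOrd f g = relOrd f g' := by
  rw [relOrd, relOrd, (Ideal.Quotient.mk_eq_mk_iff_sub_mem g g').mpr
    (Ideal.mem_span_singleton.mpr h)]

theorem relOrd_of_isUnit {f g : R} (h : IsUnit g) : relOrd f g = 0 := by
  rw [relOrd, Ring.ord, Module.length_eq_zero_iff, Ideal.Quotient.subsingleton_iff,
    Ideal.span_singleton_eq_top]
  exact h.map _

/-- Length is unchanged under restriction of scalars along a surjection. Over `R` the two equations
play symmetric roles, which yields `relOrd_comm`. -/
theorem ord_quotient_mk (I : Ideal R) (g : R) :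
    Ring.ord (R ⧸ I) (Ideal.Quotient.mk I g) = Module.length R (R ⧸ (I ⊔ Ideal.span {g})) := by
  have h : Ideal.span {Ideal.Quotient.mk I g} =
      (Ideal.span {g}).map (Ideal.Quotient.mkₐ R I) := by
    rw [Ideal.map_span, Set.image_singleton]; rfl
  rw [Ring.ord, h, ← Module.length_eq_of_surjective (S := R) Ideal.Quotient.mk_surjective]
  exact (DoubleQuot.quotQuotEquivQuotSupₐ R I (Ideal.span {g})).toLinearEquiv.length_eq

theorem relOrd_comm (f g : R) : relOrd f g = relOrd g f := by
  rw [relOrd, relOrd, ord_quotient_mk, ord_quotient_mk, sup_comm]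

theorem relOrd_eq_one {f g : R} (h : (Ideal.span {f, g}).IsMaximal) : relOrd f g = 1 := by
  rw [relOrd, ord_quotient_mk, ← Ideal.span_union, Set.singleton_union, Module.length_eq_one_iff,
    isSimpleModule_iff_quot_maximal]
  exact ⟨_, h, ⟨LinearEquiv.refl _ _⟩⟩

end RelativeOrder

/-! ### Intersection numbers in the local ring of a point of the plane. -/

section LocalIntersection

variable {K : Type*} [Field K] (a : Fin 2 → K)

/-- The map from polynomials to the local ring of the plane at `a`. -/
noncomputable abbrev toLocal : MvPolynomial (Fin 2) K →+* PlaneLocalRing a := algebraMap _ _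

variable {a}

theorem isUnit_toLocal {g : MvPolynomial (Fin 2) K} (hg : eval a g ≠ 0) : IsUnit (toLocal a g) :=
  IsLocalization.map_units (PlaneLocalRing a) (⟨g, hg⟩ : (RingHom.ker (eval a)).primeCompl)

/-- Clear denominators: they do not vanish at `a`, so `π` cannot divide them. -/
theorem toLocal_prime_dvd {π f : MvPolynomial (Fin 2) K} (hπ : Prime π) (h0 : eval a π = 0)
    (h : toLocal a π ∣ toLocal a f) : π ∣ f := by
  obtain ⟨x, hx⟩ := h
  obtain ⟨⟨b, s⟩, hb⟩ := IsLocalization.surj (RingHom.ker (eval a)).primeCompl x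
  have hinj : Function.Injective (toLocal a) :=
    IsLocalization.injective (PlaneLocalRing a)
      (Ideal.primeCompl_le_nonZeroDivisors (RingHom.ker (eval a)))
  have h1 : f * s = π * b := hinj (by
    rw [map_mul, map_mul, hx, mul_assoc]; exact congrArg _ hb)
  refine (hπ.dvd_or_dvd (h1 ▸ dvd_mul_right π b)).resolve_right fun hs => s.2 ?_
  obtain ⟨c, hc⟩ := hs
  change eval a _ = 0
  rw [hc, map_mul, h0, zero_mul]

theorem prime_toLocal {π : MvPolynomial (Fin 2) K} (hπ : Prime π) (h0 : eval a π = 0) :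
    Prime (toLocal a π) := by
  have hP : (Ideal.span {π}).IsPrime := (Ideal.span_singleton_prime hπ.ne_zero).mpr hπ
  have hdis : Disjoint ((RingHom.ker (eval a)).primeCompl : Set (MvPolynomial (Fin 2) K))
      (Ideal.span {π} : Ideal _) := by
    rw [Set.disjoint_right]
    intro x hx hx'
    obtain ⟨c, rfl⟩ := Ideal.mem_span_singleton.mp hx
    exact hx' (by change eval a _ = 0; rw [map_mul, h0, zero_mul])
  have hinj : Function.Injective (toLocal a) :=
    IsLocalization.injective (PlaneLocalRing a)
      (Ideal.primeCompl_le_nonZeroDivisors (RingHom.ker (eval a)))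
  have := IsLocalization.isPrime_of_isPrime_disjoint (RingHom.ker (eval a)).primeCompl
    (PlaneLocalRing a) (Ideal.span {π}) hP hdis
  rw [Ideal.map_span, Set.image_singleton] at this
  exact (Ideal.span_singleton_prime ((map_ne_zero_iff _ hinj).mpr hπ.ne_zero)).mp this

theorem regularMod_toLocal {π f : MvPolynomial (Fin 2) K} (hπ : Prime π) (h : ¬ π ∣ f) :
    RegularMod (toLocal a f) (toLocal a π) := by
  by_cases h0 : eval a π = 0
  · exact .of_prime (prime_toLocal hπ h0) fun h1 => h (toLocal_prime_dvd hπ h0 h1)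
  · exact .of_isUnit (isUnit_toLocal h0)

theorem relOrd_toLocal_eq_one {f g : MvPolynomial (Fin 2) K}
    (h : RingHom.ker (eval a) = Ideal.span {f, g}) :
    relOrd (toLocal a f) (toLocal a g) = 1 := by
  refine relOrd_eq_one ?_
  have h1 := congrArg (Ideal.map (toLocal a)) h
  rw [Ideal.map_span, Set.image_insert_eq, Set.image_singleton,
    Localization.AtPrime.map_eq_maximalIdeal] at h1
  rw [← h1]
  infer_instance

/-- If `ℓ` and `u` are local coordinates at `a`, and `f` restricts to a unit times `u ^ n` on the
curve `ℓ = 0`, then `f` meets `ℓ` with multiplicity `n`. -/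
theorem relOrd_eq_of_dvd_sub {f ℓ u v : MvPolynomial (Fin 2) K} {n : ℕ} (hu : Prime u)
    (huℓ : ¬ u ∣ ℓ) (hℓ : Prime ℓ) (hℓu : ¬ ℓ ∣ u)
    (hmax : RingHom.ker (eval a) = Ideal.span {ℓ, u}) (hv : eval a v ≠ 0)
    (h : ℓ ∣ f - u ^ n * v) :
    RegularMod (toLocal a f) (toLocal a ℓ) ∧ relOrd (toLocal a f) (toLocal a ℓ) = n := by
  constructor
  · refine regularMod_toLocal hℓ fun hf => ?_
    rcases hℓ.dvd_or_dvd ((dvd_sub_right hf).mp h) with h1 | ⟨w, rfl⟩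
    · exact hℓu (hℓ.dvd_of_dvd_pow h1)
    · have h0 : ℓ ∈ RingHom.ker (eval a) := hmax ▸ Ideal.subset_span (by simp)
      exact hv (by rw [map_mul, RingHom.mem_ker.mp h0, zero_mul])
  · have h' := map_dvd (toLocal a) h
    rw [map_sub, map_mul, map_pow] at h'
    have hr := regularMod_toLocal (a := a) hu huℓ
    have hv' := isUnit_toLocal hv
    -- By symmetry the order may be computed on the curve `ℓ = 0`, where `f` is `u ^ n` times a
    -- unit.
    rw [relOrd_comm, relOrd_congr h', mul_comm, relOrd_mul (.of_isUnit hv'),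
      relOrd_of_isUnit hv', relOrd_pow hr, relOrd_toLocal_eq_one hmax, mul_one, zero_add]

end LocalIntersection

theorem mem_oddPoints_iff {K : Type*} [Field K] {F G : MvPolynomial (Fin 3) K}
    {S : ℙ K (Fin 3 → K)} : S ∈ oddPoints F G ↔ eval S.rep F = 0 ∧
      ∃ n : ℕ, relOrd (toLocal (affineCoord S) (dehomogenize (chart S) F))
        (toLocal (affineCoord S) (dehomogenize (chart S) G)) = n ∧ Odd n :=
  Iff.rfl

/-! ### The pullback of g to the curve and its expansion along f₁ = 0. -/

section Identities

variable {K : Type*} [Field K]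

theorem aeval_curvePoly {A : Type*} [CommRing A] [Algebra K A] (w : Fin 3 → A)
    (f₁ f₂ : MvPolynomial (Fin 2) K) :
    aeval w (curvePoly f₁ f₂) =
      w 2 * aeval (w ∘ Fin.castSucc) f₁ - aeval (w ∘ Fin.castSucc) f₂ := by
  simp [curvePoly, aeval_rename]

theorem aeval_pullbackPoly {A : Type*} [CommRing A] [Algebra K A] (v : Fin 2 → A)
    (g : MvPolynomial (Fin 3) K) (f₁ f₂ : MvPolynomial (Fin 2) K) :
    aeval v (pullbackPoly g f₁ f₂) =
      aeval ![v 0 * aeval v f₁, v 1 * aeval v f₁, aeval v f₂] g := by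
  rw [pullbackPoly, comp_aeval_apply]
  congr 2
  ext i; fin_cases i <;> simp

/-- Modulo the equation of the curve, the parametrising triple is `f₁` times `w`, and `g` is
homogeneous. -/
theorem aeval_curvePoly_dvd {A : Type*} [CommRing A] [Algebra K A] (w : Fin 3 → A)
    {g : MvPolynomial (Fin 3) K} {n : ℕ} (hg : g.IsHomogeneous n)
    (f₁ f₂ : MvPolynomial (Fin 2) K) :
    aeval w (curvePoly f₁ f₂) ∣ aeval (w ∘ Fin.castSucc) f₁ ^ n * aeval w g -
      aeval (w ∘ Fin.castSucc) (pullbackPoly g f₁ f₂) := by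
  rw [← Ideal.mem_span_singleton, ← Ideal.Quotient.eq]
  set I := Ideal.span {aeval w (curvePoly f₁ f₂)} with hI
  let φ := Ideal.Quotient.mkₐ K I
  have h0 : φ (aeval w (curvePoly f₁ f₂)) = 0 :=
    Ideal.Quotient.eq_zero_iff_mem.mpr (Ideal.mem_span_singleton_self _)
  change φ _ = φ _
  rw [aeval_curvePoly, map_sub, sub_eq_zero, map_mul] at h0
  rw [← aeval_mul_of_isHomogeneous hg, aeval_pullbackPoly, comp_aeval_apply, comp_aeval_apply]
  congr 2
  ext i; fin_cases i <;> simp [← h0, mul_comm]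

/-- First-order Taylor expansion, valid in any characteristic: the product rule carries it through
the induction. -/
theorem sq_dvd_aeval_add_sub {A : Type*} [CommRing A] [Algebra K A] {σ : Type*} [Fintype σ]
    (c : A) (v δ : σ → A) (P : MvPolynomial σ K) :
    c ^ 2 ∣ aeval (fun i => v i + c * δ i) P - aeval v P -
      c * ∑ i, δ i * aeval v (pderiv i P) := by
  classical
  induction P using MvPolynomial.induction_on with
  | C a => simp
  | add P Q hP hQ =>
    have := dvd_add hP hQ
    simp only [map_add, mul_add, Finset.sum_add_distrib]
    convert this using 1
    ring
  | mul_X P j hP =>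
    have hs : ∑ i, δ i * aeval v (pderiv i (P * X j)) =
        (∑ i, δ i * aeval v (pderiv i P)) * v j + δ j * aeval v P := by
      have : ∀ i, δ i * aeval v (pderiv i (P * X j)) = δ i * aeval v (pderiv i P) * v j +
          if i = j then δ i * aeval v P else 0 := fun i => by
        by_cases h : i = j
        · subst h; simp; ring
        · simp [pderiv_X_of_ne (Ne.symm h), h]; ring
      simp only [this, Finset.sum_add_distrib, Finset.sum_mul, Finset.sum_ite_eq',
        Finset.mem_univ, if_true]
    rw [hs, map_mul, map_mul, aeval_X, aeval_X]
    obtain ⟨t, ht⟩ := hP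
    refine ⟨t * (v j + c * δ j) + (∑ i, δ i * aeval v (pderiv i P)) * δ j, ?_⟩
    linear_combination (v j + c * δ j) * ht

theorem aeval_zero_zero_of_isHomogeneous {A : Type*} [CommRing A] [Algebra K A] {g : MvPolynomial (Fin 3) K}
    {n : ℕ} (hg : g.IsHomogeneous n) (b : A) :
    aeval ![0, 0, b] g = b ^ n * algebraMap K A (eval ![0, 0, 1] g) := by
  have h := aeval_mul_of_isHomogeneous hg b (algebraMap K A ∘ ![0, 0, 1])
  rw [aeval_algebraMap_apply, aeval_eq_eval] at h
  rw [← h]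
  congr 2
  ext i; fin_cases i <;> simp

/-- If `g` vanishes at `(0 : 0 : 1)`, its pullback agrees to first order along `f₁ = 0` with the
pullback of the tangent line. -/
theorem sq_dvd_pullbackPoly_sub {g : MvPolynomial (Fin 3) K} {n : ℕ} (hg : g.IsHomogeneous (n + 1))
    (hQ : eval ![0, 0, 1] g = 0) (f₁ f₂ : MvPolynomial (Fin 2) K) :
    f₁ ^ 2 ∣ pullbackPoly g f₁ f₂ - f₁ * (f₂ ^ n *
      (C (eval ![0, 0, 1] (pderiv 0 g)) * X 0 + C (eval ![0, 0, 1] (pderiv 1 g)) * X 1)) := by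
  -- The increment has no last coordinate, so only the first two partial derivatives enter.
  have h := sq_dvd_aeval_add_sub f₁ ![0, 0, f₂] ![X 0, X 1, 0] g
  have hp : ∀ i, (pderiv i g).IsHomogeneous n := fun i => by simpa using hg.pderiv (i := i)
  rw [aeval_zero_zero_of_isHomogeneous hg, hQ, map_zero, mul_zero, sub_zero, Fin.sum_univ_three,
    aeval_zero_zero_of_isHomogeneous (hp 0), aeval_zero_zero_of_isHomogeneous (hp 1)] at h
  convert h using 1
  congr 1
  · rw [pullbackPoly]
    congr 2
    ext i; fin_cases i <;> simp [mul_comm]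
  · simp only [mul_eq_mul_left_iff, algebraMap_eq, Matrix.cons_val]
    exact Or.inl (by ring)

theorem dvd_pullbackPoly {g : MvPolynomial (Fin 3) K} {n : ℕ} (hg : g.IsHomogeneous (n + 1))
    (hQ : eval ![0, 0, 1] g = 0) (f₁ f₂ : MvPolynomial (Fin 2) K) :
    f₁ ∣ pullbackPoly g f₁ f₂ := by
  have h := (dvd_pow_self f₁ two_ne_zero).trans (sq_dvd_pullbackPoly_sub hg hQ f₁ f₂)
  exact (dvd_sub_left (dvd_mul_right _ _)).mp h

theorem isHomogeneous_pullbackPoly {g : MvPolynomial (Fin 3) K} {n e : ℕ}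
    (hg : g.IsHomogeneous n) {f₁ f₂ : MvPolynomial (Fin 2) K} (h₁ : f₁.IsHomogeneous e)
    (h₂ : f₂.IsHomogeneous (e + 1)) : (pullbackPoly g f₁ f₂).IsHomogeneous ((e + 1) * n) := by
  refine hg.aeval _ fun i => ?_
  fin_cases i
  · simpa [add_comm] using (isHomogeneous_X K (0 : Fin 2)).mul h₁
  · simpa [add_comm] using (isHomogeneous_X K (1 : Fin 2)).mul h₁
  · exact h₂

theorem sub_C_eval_mem {σ : Type*} {I : Ideal (MvPolynomial σ K)} {a : σ → K}
    (h : ∀ i, X i - C (a i) ∈ I) (P : MvPolynomial σ K) : P - C (eval a P) ∈ I := by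
  induction P using MvPolynomial.induction_on with
  | C c => simp
  | add P Q hP hQ =>
    convert I.add_mem hP hQ using 1
    simp; ring
  | mul_X P j hP =>
    convert I.add_mem (I.mul_mem_right (X j) hP) (I.mul_mem_left (C (eval a P)) (h j)) using 1
    simp; ring

theorem ker_eval_eq_span {f g : MvPolynomial (Fin 2) K} {a : Fin 2 → K} (hf : eval a f = 0)
    (hg : eval a g = 0) (h : ∀ i, X i - C (a i) ∈ Ideal.span {f, g}) :
    RingHom.ker (eval a) = Ideal.span {f, g} := by
  refine le_antisymm (fun P hP => ?_) (Ideal.span_le.mpr ?_)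
  · have := sub_C_eval_mem h P
    rwa [RingHom.mem_ker.mp hP, C_0, sub_zero] at this
  · rintro x (rfl | rfl)
    · exact hf
    · exact hg

end Identities

/-! ### Multiplicities away from Q. -/

section Smooth

variable {K : Type*} [Field K]

theorem X_sub_C_not_dvd {σ : Type*} {i j : σ} (hij : i ≠ j) (a b : K) :
    ¬ (X i - C a : MvPolynomial σ K) ∣ X j - C b := by
  classical
  rintro ⟨m, hm⟩
  have := congrArg (eval (Function.update (fun _ => a) j (b + 1))) hm
  simp [hij] at this

theorem aeval_sub_C_eval_dvd {v : Fin 2 → MvPolynomial (Fin 2) K} {ℓ : MvPolynomial (Fin 2) K}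
    {r : Fin 2 → K} (hv : ∀ i, ℓ ∣ v i - C (r i)) (F : MvPolynomial (Fin 2) K) :
    ℓ ∣ aeval v F - C (eval r F) := by
  rw [← Ideal.mem_span_singleton, ← Ideal.Quotient.eq]
  let φ := Ideal.Quotient.mkₐ K (Ideal.span {ℓ})
  change φ _ = φ _
  have h : ∀ i, φ (v i) = algebraMap K _ (r i) := fun i => by
    rw [← AlgHom.commutes φ]
    exact Ideal.Quotient.eq.mpr (Ideal.mem_span_singleton.mpr (hv i))
  rw [comp_aeval_apply]
  simp only [h]
  exact (aeval_algebraMap_apply _ r F).trans (AlgHom.commutes φ _).symm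

/-- The intersection multiplicity at a point outside `(0 : 0 : 1)`; the dehomogenisation `v` and
the point `r` of the projective line describe the chart. -/
theorem relOrd_eq_mult [IsAlgClosed K] {f₁ f₂ : MvPolynomial (Fin 2) K}
    {g : MvPolynomial (Fin 3) K} (hg : g.IsHomogeneous 4) {H : MvPolynomial (Fin 2) K} {n : ℕ}
    (hH : pullbackPoly g f₁ f₂ = f₁ * H) (hHn : H.IsHomogeneous n) (hH0 : H ≠ 0)
    {a r : Fin 2 → K} (hr0 : r ≠ 0) {w : Fin 3 → MvPolynomial (Fin 2) K} (hw2 : w 2 = X 1)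
    (hw : ∀ i : Fin 2, X 0 - C (a 0) ∣ w i.castSucc - C (r i))
    (hlin : ∀ p : Fin 2 → K, p ≠ 0 → eval r (lin p) = 0 → ∃ c : K, c ≠ 0 ∧
      aeval (w ∘ Fin.castSucc) (lin p) = C c * (X 0 - C (a 0)))
    (hr : eval r f₁ ≠ 0) (ha : a 1 * eval r f₁ = eval r f₂) :
    relOrd (toLocal a (aeval w (curvePoly f₁ f₂))) (toLocal a (aeval w g)) = mult r H := by
  classical
  set v := w ∘ Fin.castSucc with hv
  set f := aeval w (curvePoly f₁ f₂) with hf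
  have hℓ : ∀ P : MvPolynomial (Fin 2) K, X 0 - C (a 0) ∣ aeval v P - C (eval r P) :=
    aeval_sub_C_eval_dvd hw
  have heval : ∀ P : MvPolynomial (Fin 2) K, eval a (aeval v P) = eval r P := fun P => by
    have h := map_dvd (eval a) (hℓ P)
    simp only [map_sub, eval_X, eval_C, sub_self, zero_dvd_iff] at h
    exact sub_eq_zero.mp h
  -- On the line `X 0 = a 0` the curve restricts to a nonzero constant times `X 1 - a 1`, so `X 0 -
  -- a 0` has order 1 on the curve at `a`.
  obtain ⟨hreg, hone⟩ := relOrd_eq_of_dvd_sub (a := a) (f := f) (ℓ := X 0 - C (a 0))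
    (u := X 1 - C (a 1)) (v := C (eval r f₁)) (n := 1) (prime_X_sub_C _ _)
    (X_sub_C_not_dvd (by decide) _ _) (prime_X_sub_C _ _) (X_sub_C_not_dvd (by decide) _ _)
    (ker_eval_eq_span (by simp) (by simp) fun i => by
      fin_cases i <;> exact Ideal.subset_span (by simp)) (by simpa using hr) (by
      rw [hf, aeval_curvePoly, hw2]
      have hC : (C (a 1) * C (eval r f₁) : MvPolynomial (Fin 2) K) = C (eval r f₂) := by
        rw [← C_mul, ha]
      convert dvd_sub ((hℓ f₁).mul_left (X 1)) (hℓ f₂) using 1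
      linear_combination hC)
  -- A linear factor vanishing at `r` becomes a constant multiple of `X 0 - a 0`; every other one
  -- becomes a unit.
  have key : ∀ {m : ℕ} {F : MvPolynomial (Fin 2) K}, F.IsHomogeneous m → F ≠ 0 →
      relOrd (toLocal a f) (toLocal a (aeval v F)) = mult r F := fun {m F} hF hF0 => by
    refine binaryForm_induction (P := fun _ F =>
      relOrd (toLocal a f) (toLocal a (aeval v F)) = mult r F) (fun c hc => ?_) ?_ hF hF0
    · rw [mult_C hr0 hc, relOrd_of_isUnit (isUnit_toLocal (by simpa using hc)), Nat.cast_zero]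
    · intro m p F hp hF hF0 ih
      rw [map_mul, map_mul, mult_mul hr0 (lin_ne_zero hp) hF0, mult_lin hr0 hp]
      split_ifs with h
      · obtain ⟨c, hc, he⟩ := hlin p hp h
        have hcu : IsUnit (toLocal a (C c)) := isUnit_toLocal (by simpa using hc)
        rw [he, map_mul, relOrd_mul (.mul (.of_isUnit hcu) hreg), relOrd_mul (.of_isUnit hcu),
          relOrd_of_isUnit hcu, hone, ih]
        push_cast; ring
      · have hu : IsUnit (toLocal a (aeval v (lin p))) := isUnit_toLocal (by rwa [heval])
        rw [relOrd_mul (.of_isUnit hu), relOrd_of_isUnit hu, ih]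
        push_cast; ring
  have hdvd := map_dvd (toLocal a) (aeval_curvePoly_dvd w hg f₁ f₂)
  rw [map_sub, hH] at hdvd
  have hu : IsUnit (toLocal a (aeval v f₁)) := isUnit_toLocal (by rwa [heval])
  have h := relOrd_congr hdvd
  rw [← hv, map_mul, map_mul, map_mul, map_pow, relOrd_mul (.of_isUnit (hu.pow 4)),
    relOrd_mul (.of_isUnit hu), relOrd_of_isUnit hu, relOrd_of_isUnit (hu.pow 4), zero_add,
    zero_add, key hHn hH0] at h
  exact h

end Smooth

/-! ### The multiplicity at Q. -/

section Origin

variable {K : Type*} [Field K] {e : ℕ} {f₁ f₂ : MvPolynomial (Fin 2) K}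

/-- With `u = lin q` as parameter on the line `lin p = 0`, the curve restricts to f₁(p) uᵉ - f₂(p)
uᵉ⁺¹, and f₂(p) ≠ 0 whenever f₁(p) = 0. -/
theorem lin_relOrd_origin [DecidableEq K] (h₁ : f₁.IsHomogeneous e)
    (h₂ : f₂.IsHomogeneous (e + 1)) (hco : ∀ p : Fin 2 → K, p ≠ 0 → eval p f₁ = 0 → eval p f₂ ≠ 0)
    {p : Fin 2 → K} (hp : p ≠ 0) :
    RegularMod (toLocal 0 (f₁ - f₂)) (toLocal 0 (lin p)) ∧
    relOrd (toLocal 0 (f₁ - f₂)) (toLocal 0 (lin p)) =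
      ((e + if eval p f₁ = 0 then 1 else 0 : ℕ) : ℕ∞) := by
  obtain ⟨q, hq⟩ := exists_eval_lin_eq_one hp
  have hq0 : q ≠ 0 := by rintro rfl; simp at hq
  have hmax : RingHom.ker (eval (0 : Fin 2 → K)) = Ideal.span {lin p, lin q} := by
    refine ker_eval_eq_span (by rw [eval_lin]; simp) (by rw [eval_lin]; simp) fun i => ?_
    have hi : X i - C 0 = C (-q i) * lin p + C (p i) * lin q := by
      have hC : (C (q 1) * C (p 0) - C (q 0) * C (p 1) : MvPolynomial (Fin 2) K) = 1 := by
        rw [← C_mul, ← C_mul, ← C_sub, hq, C_1]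
      fin_cases i
      · simp only [lin, Fin.zero_eta, C_neg, C_0]; linear_combination (-X 0) * hC
      · simp only [lin, Fin.mk_one, C_neg, C_0]; linear_combination (-X 1) * hC
    exact Ideal.mem_span_pair.mpr ⟨_, _, hi.symm⟩
  have hqp : ¬ lin q ∣ lin p := by
    rw [lin_dvd_iff (isHomogeneous_lin p) hq0, eval_lin]
    intro h
    exact one_ne_zero (α := K) (by linear_combination -hq - h)
  have hpq : ¬ lin p ∣ lin q := by
    rw [lin_dvd_iff (isHomogeneous_lin q) hp, eval_lin]
    intro h
    exact one_ne_zero (α := K) (by linear_combination -hq + h)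
  have hd := dvd_sub (lin_dvd_sub h₁ hq) (lin_dvd_sub h₂ hq)
  split_ifs with h
  · refine relOrd_eq_of_dvd_sub (v := C (-eval p f₂)) (prime_lin hq0) hqp (prime_lin hp) hpq hmax
      (by simpa using hco p hp h) ?_
    convert hd using 1
    simp [h]
    ring
  · refine relOrd_eq_of_dvd_sub (v := C (eval p f₁) - C (eval p f₂) * lin q) (prime_lin hq0) hqp
      (prime_lin hp) hpq hmax
      (by rw [map_sub, map_mul, eval_lin]; simpa using h) ?_
    convert hd using 1
    ring

/-- The intersection multiplicity at `(0 : 0 : 1)`, when `q` is the only zero of `H` at which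
`f₁` may vanish. -/
theorem relOrd_origin [IsAlgClosed K] [DecidableEq K] (h₁ : f₁.IsHomogeneous e)
    (h₂ : f₂.IsHomogeneous (e + 1)) (hco : ∀ p : Fin 2 → K, p ≠ 0 → eval p f₁ = 0 → eval p f₂ ≠ 0)
    (hf₁0 : f₁ ≠ 0) {g : MvPolynomial (Fin 3) K} (hg : g.IsHomogeneous 4)
    {H : MvPolynomial (Fin 2) K} (hH : pullbackPoly g f₁ f₂ = f₁ * H)
    (hHn : H.IsHomogeneous (3 * (e + 1) + 1)) (hH0 : H ≠ 0) {q : Fin 2 → K} (hq : q ≠ 0)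
    (hroot : ∀ p : Fin 2 → K, p ≠ 0 → eval p f₁ = 0 → eval p H = 0 → eval p (lin q) = 0) :
    relOrd (toLocal 0 (f₁ - f₂)) (toLocal 0 (aeval ![X 0, X 1, 1] g)) =
      ((e + if eval q f₁ = 0 then mult q H else 0 : ℕ) : ℕ∞) := by
  have hlin := fun {p : Fin 2 → K} (hp : p ≠ 0) => lin_relOrd_origin h₁ h₂ hco hp
  have hconst : ∀ c : K, c ≠ 0 → IsUnit (toLocal 0 (C c : MvPolynomial (Fin 2) K)) :=
    fun c hc => isUnit_toLocal (by simpa using hc)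
  -- Every linear factor of `f₁` is a tangent direction, of order e + 1.
  obtain ⟨hreg, hf₁⟩ := binaryForm_induction (P := fun m F => F ∣ f₁ →
      RegularMod (toLocal 0 (f₁ - f₂)) (toLocal 0 F) ∧
      relOrd (toLocal 0 (f₁ - f₂)) (toLocal 0 F) = (((e + 1) * m : ℕ) : ℕ∞))
    (fun c hc _ => ⟨.of_isUnit (hconst c hc), by
      rw [relOrd_of_isUnit (hconst c hc), mul_zero, Nat.cast_zero]⟩)
    (fun m p F hp hF hF0 ih hdvd => by
      obtain ⟨ih₁, ih₂⟩ := ih ((dvd_mul_left _ _).trans hdvd)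
      have h0 : eval p f₁ = 0 := (lin_dvd_iff h₁ hp).mp ((dvd_mul_right _ _).trans hdvd)
      obtain ⟨hl₁, hl₂⟩ := hlin hp
      rw [map_mul]
      refine ⟨hl₁.mul ih₁, ?_⟩
      rw [relOrd_mul hl₁, hl₂, ih₂, if_pos h0]
      push_cast; ring) h₁ hf₁0 dvd_rfl
  -- Every linear factor of `H` has order e, with one more exactly when it is proportional to `lin
  -- q` and f₁(q) = 0.
  have hHord := binaryForm_induction (P := fun m F => F ∣ H →
      relOrd (toLocal 0 (f₁ - f₂)) (toLocal 0 F) =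
        ((m * e + if eval q f₁ = 0 then mult q F else 0 : ℕ) : ℕ∞))
    (fun c hc _ => by
      rw [relOrd_of_isUnit (hconst c hc), mult_C hq hc]
      simp)
    (fun m p F hp hF hF0 ih hdvd => by
      have ih := ih ((dvd_mul_left _ _).trans hdvd)
      have h0 : eval p H = 0 := (lin_dvd_iff hHn hp).mp ((dvd_mul_right _ _).trans hdvd)
      obtain ⟨hl₁, hl₂⟩ := hlin hp
      have hsame : eval p f₁ = 0 ↔ eval q f₁ = 0 ∧ eval q (lin p) = 0 := by
        constructor
        · intro h
          have h3 := hroot p hp h h0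
          have h4 := eval_lin q p
          rw [h3] at h4
          obtain ⟨c, rfl⟩ := exists_smul_eq_of_lin hp (q := q) (by linear_combination h4)
          rw [eval_smul_of_isHomogeneous h₁, h, mul_zero]
          exact ⟨rfl, by simp; ring⟩
        · rintro ⟨h, h3⟩
          have h4 := eval_lin p q
          rw [h3] at h4
          obtain ⟨c, rfl⟩ := exists_smul_eq_of_lin hq (q := p) (by linear_combination h4)
          rw [eval_smul_of_isHomogeneous h₁, h, mul_zero]
      rw [map_mul, relOrd_mul hl₁, hl₂, ih, mult_mul hq (lin_ne_zero hp) hF0, mult_lin hq hp,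
        ← Nat.cast_add]
      congr 1
      simp only [hsame]
      by_cases h5 : eval q f₁ = 0
      · simp only [h5, true_and, if_true]; ring
      · simp only [h5, false_and, if_false]; ring) hHn hH0 dvd_rfl
  have hdvd := aeval_curvePoly_dvd (![X 0, X 1, 1] : Fin 3 → MvPolynomial (Fin 2) K) hg f₁ f₂
  have hv : (![X 0, X 1, 1] : Fin 3 → MvPolynomial (Fin 2) K) ∘ Fin.castSucc =
      (X : Fin 2 → MvPolynomial (Fin 2) K) := by
    funext i; fin_cases i <;> simp
  rw [aeval_curvePoly, hv, aeval_X_left_apply, aeval_X_left_apply, aeval_X_left_apply, hH,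
    show f₁ ^ 4 * aeval ![X 0, X 1, 1] g - f₁ * H =
      f₁ * (f₁ ^ 3 * aeval ![X 0, X 1, 1] g - H) by ring,
    show (![X 0, X 1, 1] : Fin 3 → MvPolynomial (Fin 2) K) 2 = 1 from rfl, one_mul] at hdvd
  have h2 := map_dvd (toLocal (0 : Fin 2 → K)) hdvd
  rw [map_mul] at h2
  -- Cancel the regular element `f₁` from f₁⁴ g = f₁ H on the curve.
  have h3 := hreg _ h2
  rw [map_sub (toLocal 0) (f₁ ^ 3 * _) H, map_mul, map_pow] at h3
  have h4 := relOrd_congr h3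
  rw [relOrd_mul (by rw [pow_succ, sq]; exact (hreg.mul hreg).mul hreg), relOrd_pow hreg, hf₁,
    hHord] at h4
  generalize (if eval q f₁ = 0 then mult q H else 0) = E at h4 ⊢
  generalize relOrd (toLocal 0 (f₁ - f₂)) _ = x at h4 ⊢
  -- Solve 3e(e+1) + x = e(3e+4) + E for x; the finite right side excludes x = ∞.
  induction x using ENat.recTopCoe with
  | top => exact absurd ((add_top _).symm.trans h4).symm (ENat.natCast_ne_top _)
  | coe x =>
    norm_cast at h4 ⊢
    linarith

end Origin

/-! ### Passage to the projective curve and the parity conditions. -/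

section Charts

variable {K : Type*} [Field K]

theorem dehomogenize_zero (F : MvPolynomial (Fin 3) K) :
    dehomogenize 0 F = aeval ![1, X 0, X 1] F := by
  rw [dehomogenize]
  congr 2
  funext i; fin_cases i <;> rfl

theorem dehomogenize_one (F : MvPolynomial (Fin 3) K) :
    dehomogenize 1 F = aeval ![X 0, 1, X 1] F := by
  rw [dehomogenize]
  congr 2
  funext i; fin_cases i <;> rfl

theorem dehomogenize_two (F : MvPolynomial (Fin 3) K) :
    dehomogenize 2 F = aeval ![X 0, X 1, 1] F := by
  rw [dehomogenize]
  congr 2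
  funext i; fin_cases i <;> rfl

theorem dehomogenize_two_curvePoly (f₁ f₂ : MvPolynomial (Fin 2) K) :
    dehomogenize 2 (curvePoly f₁ f₂) = f₁ - f₂ := by
  have hv : (![X 0, X 1, 1] : Fin 3 → MvPolynomial (Fin 2) K) ∘ Fin.castSucc =
      (X : Fin 2 → MvPolynomial (Fin 2) K) := by
    funext i; fin_cases i <;> simp
  rw [dehomogenize_two, aeval_curvePoly, hv, aeval_X_left_apply, aeval_X_left_apply]
  simp

theorem chart_eq_two {S : ℙ K (Fin 3 → K)} (h0 : S.rep 0 = 0) (h1 : S.rep 1 = 0) :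
    chart S = 2 := by
  simp [chart, h0, h1]

theorem affineCoord_eq_zero {S : ℙ K (Fin 3 → K)} (h0 : S.rep 0 = 0) (h1 : S.rep 1 = 0) :
    affineCoord S = 0 := by
  funext i
  rw [affineCoord, chart_eq_two h0 h1]
  fin_cases i
  · exact (congrArg (· / S.rep 2) h0).trans (zero_div _)
  · exact (congrArg (· / S.rep 2) h1).trans (zero_div _)

theorem rep_pointQ : (pointQ K).rep 0 = 0 ∧ (pointQ K).rep 1 = 0 := by
  obtain ⟨c, hc⟩ := Projectivization.exists_smul_eq_mk_rep K (![0, 0, 1] : Fin 3 → K)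
    (fun h => one_ne_zero (congrFun h 2))
  rw [pointQ, ← hc]
  simp

theorem eval_curvePoly (x : Fin 3 → K) (f₁ f₂ : MvPolynomial (Fin 2) K) :
    eval x (curvePoly f₁ f₂) = x 2 * eval (x ∘ Fin.castSucc) f₁ - eval (x ∘ Fin.castSucc) f₂ := by
  simpa only [aeval_eq_eval] using aeval_curvePoly x f₁ f₂

variable [IsAlgClosed K] {e : ℕ} {f₁ f₂ : MvPolynomial (Fin 2) K}
  {g : MvPolynomial (Fin 3) K} {H : MvPolynomial (Fin 2) K}

/-- Off Q the chart is one of the first two. Scaling the representative to make the chart coordinate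
1 changes neither the order of `H` nor the equation of the curve, and reduces to `relOrd_eq_mult`.
-/
theorem relOrd_chart (h₁ : f₁.IsHomogeneous e)
    (h₂ : f₂.IsHomogeneous (e + 1)) (hg : g.IsHomogeneous 4) {n : ℕ}
    (hH : pullbackPoly g f₁ f₂ = f₁ * H) (hHn : H.IsHomogeneous n) (hH0 : H ≠ 0)
    {S : ℙ K (Fin 3 → K)} (hS : eval S.rep (curvePoly f₁ f₂) = 0)
    (hr : eval (S.rep ∘ Fin.castSucc) f₁ ≠ 0) (hr0 : S.rep ∘ Fin.castSucc ≠ 0) :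
    relOrd (toLocal (affineCoord S) (dehomogenize (chart S) (curvePoly f₁ f₂)))
      (toLocal (affineCoord S) (dehomogenize (chart S) g)) =
        mult (S.rep ∘ Fin.castSucc) H := by
  have hscale : ∀ c : K, c ≠ 0 →
      eval (c • (S.rep ∘ Fin.castSucc)) f₁ ≠ 0 ∧ c • (S.rep ∘ Fin.castSucc) ≠ 0 ∧
      (c * S.rep 2) * eval (c • (S.rep ∘ Fin.castSucc)) f₁ =
        eval (c • (S.rep ∘ Fin.castSucc)) f₂ := fun c hc => by
    refine ⟨?_, smul_ne_zero hc hr0, ?_⟩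
    · rw [eval_smul_of_isHomogeneous h₁]
      exact mul_ne_zero (pow_ne_zero _ hc) hr
    · rw [eval_smul_of_isHomogeneous h₁, eval_smul_of_isHomogeneous h₂]
      rw [eval_curvePoly] at hS
      linear_combination c ^ (e + 1) * hS
  by_cases h0 : S.rep 0 = 0
  · have h1 : S.rep 1 ≠ 0 := fun h1 => hr0 (by funext i; fin_cases i <;> simpa)
    have hchart : chart S = 1 := by simp [chart, h0, h1]
    have ha0 : affineCoord S 0 = (S.rep 1)⁻¹ * S.rep 0 := by
      rw [affineCoord, hchart, ← div_eq_inv_mul]; rfl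
    have ha1 : affineCoord S 1 = (S.rep 1)⁻¹ * S.rep 2 := by
      rw [affineCoord, hchart, ← div_eq_inv_mul]; rfl
    have hr' : (S.rep 1)⁻¹ • (S.rep ∘ Fin.castSucc) = ![affineCoord S 0, 1] := by
      rw [ha0]; funext i; fin_cases i <;> simp [h1]
    obtain ⟨hs₁, hs₂, hs₃⟩ := hscale _ (inv_ne_zero h1)
    rw [← mult_smul (inv_ne_zero h1), hchart, dehomogenize_one, dehomogenize_one]
    rw [← ha1] at hs₃
    rw [hr'] at hs₁ hs₂ hs₃ ⊢
    refine relOrd_eq_mult hg hH hHn hH0 hs₂ rfl (fun i => ?_) (fun p hp h => ?_) hs₁ hs₃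
    · fin_cases i <;> simp
    · rw [eval_lin] at h
      simp only [Matrix.cons_val_zero, Matrix.cons_val_one, mul_one] at h
      have hp0 : p 0 = p 1 * affineCoord S 0 := by linear_combination -h
      refine ⟨p 1, fun h' => hp (by funext i; fin_cases i <;> simp [hp0, h']), ?_⟩
      simp [lin, hp0, algebraMap_eq]
      ring
  · have hchart : chart S = 0 := by simp [chart, h0]
    have ha0 : affineCoord S 0 = (S.rep 0)⁻¹ * S.rep 1 := by
      rw [affineCoord, hchart, ← div_eq_inv_mul]; rfl
    have ha1 : affineCoord S 1 = (S.rep 0)⁻¹ * S.rep 2 := by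
      rw [affineCoord, hchart, ← div_eq_inv_mul]; rfl
    have hr' : (S.rep 0)⁻¹ • (S.rep ∘ Fin.castSucc) = ![1, affineCoord S 0] := by
      rw [ha0]; funext i; fin_cases i <;> simp [h0]
    obtain ⟨hs₁, hs₂, hs₃⟩ := hscale _ (inv_ne_zero h0)
    rw [← mult_smul (inv_ne_zero h0), hchart, dehomogenize_zero, dehomogenize_zero]
    rw [← ha1] at hs₃
    rw [hr'] at hs₁ hs₂ hs₃ ⊢
    refine relOrd_eq_mult hg hH hHn hH0 hs₂ rfl (fun i => ?_) (fun p hp h => ?_) hs₁ hs₃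
    · fin_cases i <;> simp
    · rw [eval_lin] at h
      simp only [Matrix.cons_val_zero, Matrix.cons_val_one, mul_one] at h
      have hp1 : p 1 = p 0 * affineCoord S 0 := by linear_combination h
      refine ⟨-p 0, fun h' => ?_, ?_⟩
      · have h'' : p 0 = 0 := by simpa using h'
        exact hp (by funext i; fin_cases i <;> simp [hp1, h''])
      · simp [lin, hp1, algebraMap_eq]
        ring

theorem oddPoints_eq_empty_iff [DecidableEq K] (h₁ : f₁.IsHomogeneous e)
    (h₂ : f₂.IsHomogeneous (e + 1)) (hco : ∀ p : Fin 2 → K, p ≠ 0 → eval p f₁ = 0 → eval p f₂ ≠ 0)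
    (hf₁0 : f₁ ≠ 0) (he : e ≠ 0) (hg : g.IsHomogeneous 4)
    (hH : pullbackPoly g f₁ f₂ = f₁ * H) (hHn : H.IsHomogeneous (3 * (e + 1) + 1)) (hH0 : H ≠ 0)
    {q : Fin 2 → K} (hq : q ≠ 0)
    (hroot : ∀ p : Fin 2 → K, p ≠ 0 → eval p f₁ = 0 → eval p H = 0 → eval p (lin q) = 0) :
    oddPoints (curvePoly f₁ f₂) g = ∅ ↔
      (∀ p : Fin 2 → K, p ≠ 0 → eval p f₁ ≠ 0 → Even (mult p H)) ∧
        Even (e + if eval q f₁ = 0 then mult q H else 0) := by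
  have hQ : ∀ S : ℙ K (Fin 3 → K), S.rep 0 = 0 → S.rep 1 = 0 →
      relOrd (toLocal (affineCoord S) (dehomogenize (chart S) (curvePoly f₁ f₂)))
        (toLocal (affineCoord S) (dehomogenize (chart S) g)) =
          ((e + if eval q f₁ = 0 then mult q H else 0 : ℕ) : ℕ∞) := fun S h0 h1 => by
    rw [chart_eq_two h0 h1, affineCoord_eq_zero h0 h1, dehomogenize_two_curvePoly,
      dehomogenize_two]
    exact relOrd_origin h₁ h₂ hco hf₁0 hg hH hHn hH0 hq hroot
  rw [Set.eq_empty_iff_forall_notMem]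
  simp only [mem_oddPoints_iff, not_and, not_exists, Nat.not_odd_iff_even]
  constructor
  · intro h
    constructor
    · intro p hp hpf
      have hx0 : (![p 0 * eval p f₁, p 1 * eval p f₁, eval p f₂] : Fin 3 → K) ≠ 0 := fun hx => by
        refine hp (funext fun i => ?_)
        fin_cases i
        · simpa [hpf] using congrFun hx 0
        · simpa [hpf] using congrFun hx 1
      obtain ⟨c, hc⟩ := Projectivization.exists_smul_eq_mk_rep K _ hx0
      set S := Projectivization.mk K _ hx0
      have hcf : (c : K) * eval p f₁ ≠ 0 := mul_ne_zero c.ne_zero hpf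
      have hrep : S.rep ∘ Fin.castSucc = ((c : K) * eval p f₁) • p := by
        rw [← hc]
        funext i
        fin_cases i <;> simp [Units.smul_def] <;> ring
      have hrep2 : S.rep 2 = c * eval p f₂ := by rw [← hc]; simp [Units.smul_def]
      have hS : eval S.rep (curvePoly f₁ f₂) = 0 := by
        rw [eval_curvePoly, hrep, hrep2, eval_smul_of_isHomogeneous h₁,
          eval_smul_of_isHomogeneous h₂]
        ring
      have hm := relOrd_chart h₁ h₂ hg hH hHn hH0 hS
        (by rw [hrep, eval_smul_of_isHomogeneous h₁]; exact mul_ne_zero (pow_ne_zero _ hcf) hpf)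
        (by rw [hrep]; exact smul_ne_zero hcf hp)
      rw [hrep, mult_smul hcf] at hm
      exact h S hS _ hm
    · have hS : eval (pointQ K).rep (curvePoly f₁ f₂) = 0 := by
        have : (pointQ K).rep ∘ Fin.castSucc = (0 : K) • 0 := by
          funext i; fin_cases i <;> simp [rep_pointQ]
        rw [eval_curvePoly, this, eval_smul_of_isHomogeneous h₁, eval_smul_of_isHomogeneous h₂]
        simp [he]
      exact h _ hS _ (hQ _ rep_pointQ.1 rep_pointQ.2)
  · rintro ⟨hp, hq'⟩ S hS n hn
    by_cases h0 : S.rep 0 = 0 ∧ S.rep 1 = 0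
    · rw [hQ S h0.1 h0.2, Nat.cast_inj] at hn
      rwa [← hn]
    · have hr0 : S.rep ∘ Fin.castSucc ≠ 0 := fun h => h0 ⟨congrFun h 0, congrFun h 1⟩
      have hr : eval (S.rep ∘ Fin.castSucc) f₁ ≠ 0 := fun h => by
        refine hco _ hr0 h ?_
        rw [eval_curvePoly, h] at hS
        linear_combination -hS
      rw [relOrd_chart h₁ h₂ hg hH hHn hH0 hS hr hr0, Nat.cast_inj] at hn
      rw [← hn]
      exact hp _ hr0 hr

/-- The parity conditions at all points of the curve, in terms of `H`. -/
theorem oddPoints_eq_empty_iff_isSquare [DecidableEq K] (h₁ : f₁.IsHomogeneous e)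
    (h₂ : f₂.IsHomogeneous (e + 1)) (hco : ∀ p : Fin 2 → K, p ≠ 0 → eval p f₁ = 0 → eval p f₂ ≠ 0)
    (hf₁0 : f₁ ≠ 0) (he : e ≠ 0) (hg : g.IsHomogeneous 4)
    (hH : pullbackPoly g f₁ f₂ = f₁ * H) (hHn : H.IsHomogeneous (3 * (e + 1) + 1)) (hH0 : H ≠ 0)
    {q : Fin 2 → K} (hq : q ≠ 0)
    (hroot : ∀ p : Fin 2 → K, p ≠ 0 → eval p f₁ = 0 → eval p H = 0 → eval p (lin q) = 0) :
    (Even e → (oddPoints (curvePoly f₁ f₂) g = ∅ ↔ IsSquare H)) ∧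
    (Odd e → (oddPoints (curvePoly f₁ f₂) g = ∅ ↔
      eval q f₁ = 0 ∧ ∃ m, H = lin q * m ∧ IsSquare m)) := by
  rw [oddPoints_eq_empty_iff h₁ h₂ hco hf₁0 he hg hH hHn hH0 hq hroot]
  -- Zeros of `f₁` other than `q` give no point of the curve off Q, but also impose no condition:
  -- `H` has order 0 there.
  have hother : ∀ p : Fin 2 → K, p ≠ 0 → eval p f₁ = 0 → eval p (lin q) ≠ 0 → mult p H = 0 :=
    fun p hp h h' => mult_eq_zero.mpr fun hd =>
      h' (hroot p hp h ((lin_dvd_iff hHn hp).mp hd))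
  have hsame : ∀ p : Fin 2 → K, p ≠ 0 → eval p (lin q) = 0 →
      ∃ c : K, c ≠ 0 ∧ p = c • q := fun p hp h => by
    rw [eval_lin] at h
    obtain ⟨c, rfl⟩ := exists_smul_eq_of_lin hq h
    exact ⟨c, fun hc => hp (by simp [hc]), rfl⟩
  constructor
  · intro hev
    rw [isSquare_iff_forall_even_mult hHn hH0, Nat.even_add]
    simp only [hev, true_iff]
    constructor
    · rintro ⟨ha, hb⟩ p hp
      by_cases hpf : eval p f₁ = 0
      · by_cases hpq : eval p (lin q) = 0
        · obtain ⟨c, hc, rfl⟩ := hsame p hp hpq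
          rw [eval_smul_of_isHomogeneous h₁, mul_eq_zero] at hpf
          rw [if_pos (hpf.resolve_left (pow_ne_zero _ hc))] at hb
          rwa [mult_smul hc]
        · rw [hother p hp hpf hpq]
          exact Even.zero
      · exact ha p hp hpf
    · intro h
      refine ⟨fun p hp _ => h p hp, ?_⟩
      split_ifs
      · exact h q hq
      · exact Even.zero
  · intro hodd
    have hne : ¬ Even e := Nat.not_even_iff_odd.mpr hodd
    rw [Nat.even_add]
    simp only [hne, false_iff]
    have hmult : ∀ {m : MvPolynomial (Fin 2) K}, H = lin q * m → ∀ p : Fin 2 → K, p ≠ 0 →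
        mult p H = (if eval p (lin q) = 0 then 1 else 0) + mult p m := fun {m} hm p hp => by
      have hm0 : m ≠ 0 := by rintro rfl; exact hH0 (by rw [hm, mul_zero])
      rw [hm, mult_mul hp (lin_ne_zero hq) hm0, mult_lin hp hq]
    have hmhom : ∀ {m : MvPolynomial (Fin 2) K}, H = lin q * m →
        m.IsHomogeneous (3 * (e + 1)) := fun {m} hm =>
      IsHomogeneous.of_mul_left (isHomogeneous_lin q) (lin_ne_zero hq)
        (by rw [← hm, add_comm 1]; exact hHn)
    have hqq : eval q (lin q) = 0 := by rw [eval_lin]; ring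
    constructor
    · rintro ⟨ha, hb⟩
      have hqf : eval q f₁ = 0 := by
        by_contra hqf
        simp [hqf] at hb
      rw [if_pos hqf] at hb
      have hdvd : lin q ∣ H := by
        by_contra hd
        rw [mult_eq_zero.mpr hd] at hb
        simp at hb
      obtain ⟨m, hm⟩ := hdvd
      have hm0 : m ≠ 0 := by rintro rfl; exact hH0 (by rw [hm, mul_zero])
      refine ⟨hqf, m, hm, (isSquare_iff_forall_even_mult (hmhom hm) hm0).mpr fun p hp => ?_⟩
      have h3 := hmult hm p hp
      by_cases hpq : eval p (lin q) = 0
      · obtain ⟨c, hc, rfl⟩ := hsame p hp hpq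
        rw [if_pos hpq, mult_smul hc] at h3
        rw [h3, Nat.even_add] at hb
        simpa using hb
      · rw [if_neg hpq, zero_add] at h3
        rw [← h3]
        by_cases hpf : eval p f₁ = 0
        · rw [hother p hp hpf hpq]
          exact Even.zero
        · exact ha p hp hpf
    · rintro ⟨hqf, m, hm, hsq⟩
      have hm0 : m ≠ 0 := by rintro rfl; exact hH0 (by rw [hm, mul_zero])
      have hev := (isSquare_iff_forall_even_mult (hmhom hm) hm0).mp hsq
      constructor
      · intro p hp hpf
        have hpq : eval p (lin q) ≠ 0 := fun hpq => by
          obtain ⟨c, hc, rfl⟩ := hsame p hp hpq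
          exact hpf (by rw [eval_smul_of_isHomogeneous h₁, hqf, mul_zero])
        rw [hmult hm p hp, if_neg hpq, zero_add]
        exact hev p hp
      · rw [if_pos hqf, hmult hm q hq, if_pos hqq, Nat.even_add]
        simp [hev q hq]

end Charts

/-! ### Base change to the algebraic closure; smoothness and the tangent line at Q. -/

section BaseChange

variable {k K : Type*} [Field k] [Field K] [Algebra k K]

theorem map_curvePoly (f₁ f₂ : MvPolynomial (Fin 2) k) :
    (curvePoly f₁ f₂).map (algebraMap k K) =
      curvePoly (f₁.map (algebraMap k K)) (f₂.map (algebraMap k K)) := by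
  simp [curvePoly, map_rename]

theorem map_pullbackPoly (g : MvPolynomial (Fin 3) k) (f₁ f₂ : MvPolynomial (Fin 2) k) :
    (pullbackPoly g f₁ f₂).map (algebraMap k K) =
      pullbackPoly (g.map (algebraMap k K)) (f₁.map (algebraMap k K))
        (f₂.map (algebraMap k K)) := by
  have hC : (MvPolynomial.map (algebraMap k K)).comp (algebraMap k (MvPolynomial (Fin 2) k)) =
      algebraMap k (MvPolynomial (Fin 2) K) := by
    ext1 a
    rw [RingHom.comp_apply, algebraMap_eq, map_C]
    rfl
  rw [pullbackPoly, pullbackPoly, aeval_map_algebraMap, map_aeval, hC, aeval_eq_eval₂Hom]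
  congr 2
  funext i
  fin_cases i <;> simp

theorem map_lin (p : Fin 2 → k) :
    (lin p).map (algebraMap k K) = lin (algebraMap k K ∘ p) := by
  simp [lin]

theorem eval_algebraMap_comp_map {σ : Type*} (p : σ → k) (F : MvPolynomial σ k) :
    eval (algebraMap k K ∘ p) (F.map (algebraMap k K)) = algebraMap k K (eval p F) := by
  rw [eval_map, ← aeval_def, aeval_algebraMap_apply, aeval_eq_eval]

/-- A singular point of the branch curve would lift, with w = 0, to a singular point of the double
plane, since the derivative 2w vanishes there too. -/
theorem exists_pderiv_ne_zero {g : MvPolynomial (Fin 3) k} (hX : IsDelPezzoDoublePlane K g)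
    {x : Fin 3 → k} (hx0 : x ≠ 0) (hx : eval x g = 0) : ∃ i, eval x (pderiv i g) ≠ 0 := by
  by_contra! hall
  let y : Fin 4 → K := Fin.snoc (α := fun _ => K) (algebraMap k K ∘ x) 0
  have hy : y ∘ Fin.castSucc = algebraMap k K ∘ x := by
    funext i; simp [y]
  have hy3 : y 3 = 0 := Fin.snoc_last (α := fun _ => K) _ _
  have hren : ∀ P : MvPolynomial (Fin 3) k, aeval y (rename Fin.castSucc P) =
      algebraMap k K (eval x P) := fun P => by
    rw [aeval_rename, hy, aeval_algebraMap_apply, aeval_eq_eval]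
  obtain ⟨i, hi⟩ := hX y (fun h => hx0 (funext fun i => by
      simpa [h] using (congrFun hy i).symm)) (by
    rw [doublePlane, map_sub, map_pow, aeval_X, hren, hx, hy3]; simp)
  refine hi ?_
  rw [doublePlane, map_sub, map_sub]
  induction i using Fin.lastCases with
  | last =>
    have : pderiv (Fin.last 3) (rename Fin.castSucc g) = 0 :=
      pderiv_eq_zero_of_notMem_vars fun h => by
        classical
        obtain ⟨j, -, hj⟩ := Finset.mem_image.mp (vars_rename _ _ h)
        exact (Fin.castSucc_lt_last j).ne hj
    rw [this, pderiv_pow]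
    simp [hy3]
  | cast j =>
    rw [pderiv_rename (Fin.castSucc_injective 3), hren, hall j, pderiv_pow]
    simp [hy3]

/-- As `h` does not involve z, the z-derivative of `g` vanishes at Q; smoothness then makes one of
the other two nonzero. -/
theorem exists_eq_lin_of_isTangentLineAtQ {g : MvPolynomial (Fin 3) k}
    (hX : IsDelPezzoDoublePlane K g) (hQ : eval ![0, 0, 1] g = 0) {h : MvPolynomial (Fin 2) k}
    (hh : IsTangentLineAtQ g h) : ∃ q : Fin 2 → k, q ≠ 0 ∧ h = lin q ∧ ∃ c : k, c ≠ 0 ∧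
      h = C c * (C (eval ![0, 0, 1] (pderiv 0 g)) * X 0 +
        C (eval ![0, 0, 1] (pderiv 1 g)) * X 1) := by
  obtain ⟨c, hc, hT⟩ := hh
  have heq : h = C c * (C (eval ![0, 0, 1] (pderiv 0 g)) * X 0 +
        C (eval ![0, 0, 1] (pderiv 1 g)) * X 1) := by
    have h1 := congrArg (aeval (![X 0, X 1, 0] : Fin 3 → MvPolynomial (Fin 2) k)) hT
    have hv : (![X 0, X 1, 0] : Fin 3 → MvPolynomial (Fin 2) k) ∘ Fin.castSucc =
        (X : Fin 2 → MvPolynomial (Fin 2) k) := by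
      funext i; fin_cases i <;> simp
    rw [aeval_rename, hv, aeval_X_left_apply] at h1
    rw [h1, tangentForm, Fin.sum_univ_three]
    simp [algebraMap_eq]
  have hz : eval ![0, 0, 1] (pderiv 2 g) = 0 := by
    have h1 := congrArg (eval (![0, 0, 1] : Fin 3 → k)) hT
    have hv : (![0, 0, 1] : Fin 3 → k) ∘ Fin.castSucc = 0 := by
      funext i; fin_cases i <;> simp
    rw [eval_rename, hv, heq, tangentForm, Fin.sum_univ_three] at h1
    simpa [hc] using h1
  refine ⟨![-(c * eval ![0, 0, 1] (pderiv 1 g)), c * eval ![0, 0, 1] (pderiv 0 g)], ?_, ?_,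
    c, hc, heq⟩
  · intro h0
    obtain ⟨i, hi⟩ := exists_pderiv_ne_zero hX (fun h => one_ne_zero (congrFun h 2)) hQ
    have h1 := congrFun h0 0
    have h2 := congrFun h0 1
    fin_cases i
    · exact hi (by simpa [hc] using h2)
    · exact hi (by simpa [hc] using h1)
    · exact hi hz
  · rw [heq, lin]
    simp only [Matrix.cons_val_zero, Matrix.cons_val_one, C_neg, C_mul]
    ring

/-- At Q the component of degree e is `f₁`, which is nonzero, so the multiplicity is at most e. -/
theorem two_le_of_isOrdinarySingularPoint {f₁ f₂ : MvPolynomial (Fin 2) K} {e : ℕ}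
    (h₁ : f₁.IsHomogeneous e) (h₂ : f₂.IsHomogeneous (e + 1)) (hf₁ : f₁ ≠ 0)
    (h : IsOrdinarySingularPoint (curvePoly f₁ f₂) (pointQ K)) : 2 ≤ e := by
  obtain ⟨m, hm, hlow, -⟩ := h
  by_contra hlt
  have h0 := hlow e (by omega)
  rw [chart_eq_two rep_pointQ.1 rep_pointQ.2, affineCoord_eq_zero rep_pointQ.1 rep_pointQ.2,
    dehomogenize_two_curvePoly] at h0
  simp only [Pi.zero_apply, C_0, add_zero] at h0
  rw [aeval_X_left_apply, map_sub, homogeneousComponent_of_mem h₁,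
    homogeneousComponent_of_mem h₂, if_pos rfl, if_neg (by omega), sub_zero] at h0
  exact hf₁ h0

end BaseChange

end QuarticPlane

/-! ### The main theorem. -/

open QuarticPlane in
theorem proposition6p3 {k K : Type*} [Field k] [Field K] [Algebra k K] [IsAlgClosure k K]
    (hchar : (2 : k) ≠ 0)
    (g : MvPolynomial (Fin 3) k) (hg : g.IsHomogeneous 4) (hX : IsDelPezzoDoublePlane K g)
    (d : ℕ) (hd : 2 ≤ d) (f₁ f₂ : MvPolynomial (Fin 2) k)
    (hf₁ : f₁.IsHomogeneous (d - 1)) (hf₂ : f₂.IsHomogeneous d) (hf : IsRelPrime f₁ f₂)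
    (hQB : MvPolynomial.eval ![0, 0, 1] g = 0) :
    f₁ ∣ pullbackPoly g f₁ f₂ ∧
    ∀ H : MvPolynomial (Fin 2) k, pullbackPoly g f₁ f₂ = f₁ * H →
    ∀ h : MvPolynomial (Fin 2) k, IsTangentLineAtQ g h →
    IsOrdinarySingularPoint ((curvePoly f₁ f₂).map (algebraMap k K)) (pointQ K) →
      (Odd d →
        (oddPoints ((curvePoly f₁ f₂).map (algebraMap k K)) (g.map (algebraMap k K)) = ∅ ↔
          IsSquare (H.map (algebraMap k K)))) ∧
      (Even d →
        (h ∣ f₁ → h ∣ H) ∧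
        (oddPoints ((curvePoly f₁ f₂).map (algebraMap k K)) (g.map (algebraMap k K)) = ∅ ↔
          h ∣ f₁ ∧ ∃ m : MvPolynomial (Fin 2) k, H = h * m ∧
            IsSquare (m.map (algebraMap k K)))) := by
  classical
  refine ⟨dvd_pullbackPoly (n := 3) hg hQB f₁ f₂, fun H hH h hh hord => ?_⟩
  have := IsAlgClosure.isAlgClosed k (K := K)
  have := IsAlgClosure.isAlgebraic (R := k) (K := K)
  obtain ⟨e, rfl⟩ : ∃ e, d = e + 1 := ⟨d - 1, by omega⟩
  rw [Nat.add_sub_cancel] at hf₁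
  have he : e ≠ 0 := by omega
  have hinj := map_injective (σ := Fin 2) (algebraMap k K) (algebraMap k K).injective
  have hF₁ := hf₁.map (algebraMap k K)
  have hF₂ := hf₂.map (algebraMap k K)
  have hco : ∀ p : Fin 2 → K, p ≠ 0 → eval p (f₁.map (algebraMap k K)) = 0 →
      eval p (f₂.map (algebraMap k K)) ≠ 0 := fun p hp h0 => by
    rw [eval_map, ← aeval_def] at h0 ⊢
    exact eval_map_ne_zero_of_isRelPrime hf₁ hf₂ hf hp h0
  have hf₁0 : f₁ ≠ 0 := by
    rintro rfl
    obtain ⟨p, hp, h0⟩ := exists_eval_eq_zero hF₂ e.succ_ne_zero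
    exact hco p hp (by simp) h0
  have hF₁0 := (map_ne_zero_iff _ hinj).mpr hf₁0
  have hHn : H.IsHomogeneous (3 * (e + 1) + 1) := by
    refine IsHomogeneous.of_mul_left hf₁ hf₁0 ?_
    rw [← hH]
    convert isHomogeneous_pullbackPoly hg hf₁ hf₂ using 1
    ring
  obtain ⟨q, hq, hlin, c, hc, hTc⟩ := exists_eq_lin_of_isTangentLineAtQ hX hQB hh
  have hdvd : f₁ ∣ C c * H - f₂ ^ 3 * h := by
    have h1 := sq_dvd_pullbackPoly_sub (n := 3) hg hQB f₁ f₂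
    rw [hH, sq, ← mul_sub, mul_dvd_mul_iff_left hf₁0] at h1
    convert h1.mul_left (C c) using 1
    rw [hTc]
    ring
  rw [map_curvePoly] at hord ⊢
  have he2 := two_le_of_isOrdinarySingularPoint hF₁ hF₂ hF₁0 hord
  -- If H = 0, then f₁ divides f₂³ h, hence h by coprimality, which is impossible since h has degree
  -- 1 and e ≥ 2.
  have hH0 : H ≠ 0 := by
    rintro rfl
    rw [mul_zero, zero_sub, dvd_neg] at hdvd
    obtain ⟨m, hm⟩ := hf.pow_right.dvd_of_dvd_mul_left hdvd
    have hl0 := lin_ne_zero hq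
    have h1 := (isHomogeneous_lin q).totalDegree hl0
    rw [← hlin, hm] at hl0
    rw [← hlin, hm, totalDegree_mul_of_isDomain hf₁0 (right_ne_zero_of_mul hl0),
      hf₁.totalDegree hf₁0] at h1
    omega
  have hQ : algebraMap k K ∘ q ≠ 0 := fun h0 => hq (funext fun i =>
    (map_eq_zero (algebraMap k K)).mp (congrFun h0 i))
  have hroot : ∀ p : Fin 2 → K, p ≠ 0 → eval p (f₁.map (algebraMap k K)) = 0 →
      eval p (H.map (algebraMap k K)) = 0 → eval p (lin (algebraMap k K ∘ q)) = 0 := by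
    intro p hp h1 h2
    have h3 := map_dvd (eval p) (map_dvd (MvPolynomial.map (algebraMap k K)) hdvd)
    rw [h1, zero_dvd_iff, hlin] at h3
    simp only [map_sub, map_mul, map_pow, map_lin, h2, mul_zero, zero_sub, neg_eq_zero,
      mul_eq_zero] at h3
    exact h3.resolve_left (pow_ne_zero _ (hco p hp h1))
  have hHK := congrArg (MvPolynomial.map (algebraMap k K)) hH
  rw [map_pullbackPoly, map_mul] at hHK
  obtain ⟨hodd, heven⟩ := oddPoints_eq_empty_iff_isSquare hF₁ hF₂ hco hF₁0 he
    (hg.map (algebraMap k K)) hHK (hHn.map _) ((map_ne_zero_iff _ hinj).mpr hH0) hQ hroot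
  have hhdvd : h ∣ f₁ → h ∣ H := fun hd => by
    have h1 := (dvd_sub_left (dvd_mul_left h (f₂ ^ 3))).mp (hd.trans hdvd)
    exact (IsUnit.dvd_mul_left ((isUnit_iff_ne_zero.mpr hc).map C)).mp h1
  have hev : eval (algebraMap k K ∘ q) (f₁.map (algebraMap k K)) = 0 ↔ h ∣ f₁ := by
    rw [eval_algebraMap_comp_map, map_eq_zero, hlin, lin_dvd_iff hf₁ hq]
  refine ⟨fun hd' => hodd ?_, fun hd' => ⟨hhdvd, ?_⟩⟩
  · rw [Nat.odd_add_one, Nat.not_odd_iff_even] at hd'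
    exact hd'
  rw [Nat.even_add_one, Nat.not_even_iff_odd] at hd'
  rw [heven hd', hev]
  -- Once h divides H over `k`, cancellation identifies the cofactor over `K` with the image of the
  -- one over `k`.
  refine and_congr_right fun hhf => ⟨?_, ?_⟩
  · rintro ⟨m, hm, hsq⟩
    obtain ⟨m', hm'⟩ := hhdvd hhf
    refine ⟨m', hm', ?_⟩
    rw [hm', map_mul, hlin, map_lin] at hm
    rwa [mul_left_cancel₀ (lin_ne_zero hQ) hm]
  · rintro ⟨m, hm, hsq⟩
    exact ⟨m.map (algebraMap k K), by rw [hm, map_mul, hlin, map_lin], hsq⟩
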